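/- **Conventions.** For a functor $F:\mathcal C\to\mathrm{Sets}$, $\mathrm{Aut}(F)$ carries the compact-open topology: the coarsest topology for which, for all $X\in\mathcal C$ and $x\in F(X)$, the map $\sigma\mapsto\sigma(x)$ to the discrete set $F(X)$ is continuous. An object $X$ is *connected* if it is not initial and every monomorphism $Y\to X$ with $Y$ not initial is an isomorphism. A pair $(\mathcal C,F)$ is an *infinite Galois category* if $\mathcal C$ has small colimits and finite limits, every object of $\mathcal C$ is a coproduct of connected objects, $\mathcal C$ is generated under colimits by a set of connected objects, and $F$ is faithful, reflects isomorphisms, and preserves small colimits and finite limits. Its *fundamental group* is $\pi_1(\mathcal C,F):=\mathrm{Aut}(F)$. It is *tame* if $\pi_1(\mathcal C,F)$ acts transitively on $F(X)$ for every connected $X$. For a topological group $G$, its Noohi completion $G^{\mathrm{Noohi}}$ is the group $\mathrm{Aut}$ of the forgetful functor on the category of discrete sets with a continuous $G$-action. The Noohi quotient of $G$ by a set of relations $\{f_i=g_i\}$ is $(G/N)^{\mathrm{Noohi}}$, where $N$ is the normal subgroup generated by the elements $f_i^{-1}g_i$. The Noohi coproduct of $G$ and $G'$ is the group $\mathrm{Aut}$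 of the forgetful functor on the category of discrete sets with a continuous $G$-action and a continuous $G'$-action; it receives continuous homomorphisms from $G$ and $G'$. Let $s\ge 1$, and let $\psi_j:\pi''_j\to\pi$ and $\phi_j:\pi''_j\to\pi'$ ($1\le j\le s$) be continuous homomorphisms of topological groups. Let $\mathbb F$ be the discrete group with generators $t_{ij}$ ($1\le i,j\le s$) and relations $t_{ii}=e$, $t_{ij}t_{jk}=t_{ik}$ (it is free of rank $s-1$), and put $t_j:=t_{1j}$. Then $\mathbf{VK}(\pi,\pi';\pi''_1,\dots,\pi''_s)_{(\psi_j),(\phi_j)}$ denotes the Noohi quotient of the Noohi coproduct of $\pi$ with the Noohi coproduct of $\pi'$ and $\mathbb F$, by the relations $\psi_j(a)=t_j^{-1}\phi_j(a)t_j$ for $1\le j\le s$ and $a\in\pi''_j$. **Proposition 1.10.** Let $s\ge 1$ and let $(\mathcal C,F)$, $(\mathcal D,G)$, $(\mathcal E_1,H_1),\dots,(\mathcal E_s,H_s)$ be tame infinite Galois categories. For $j=1,\dots,s$ let $u_j:\mathcal C\to\mathcal E_j$ and $v_j:\mathcal D\to\mathcal E_j$ be functors, and let $\alpha_j:H_j\circ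 u_j\cong F$ and $\beta_j:H_j\circ v_j\cong G$ be isomorphisms of functors. Let $\psi_j$ be the composition $\pi_1(\mathcal E_j,H_j)\to\pi_1(\mathcal C,H_j\circ u_j)\to\pi_1(\mathcal C,F)$ of restriction along $u_j$ and conjugation by $\alpha_j$, and define $\phi_j:\pi_1(\mathcal E_j,H_j)\to\pi_1(\mathcal D,G)$ in the same way from $v_j$ and $\beta_j$. Let $\mathcal C\times_{\prod_j\mathcal E_j}\mathcal D$ be the 2-fibre product, whose objects are the triples $(X,Y,\lambda)$ with $X\in\mathcal C$, $Y\in\mathcal D$ and $\lambda:(u_j(X))_j\to(v_j(Y))_j$ an isomorphism in $\prod_j\mathcal E_j$, and put $F'(X,Y,\lambda):=F(X)$. Then $$\bigl(\mathcal C\times_{\mathcal E_1\times\dots\times\mathcal E_s}\mathcal D,\;F'\bigr)$$ is a tame infinite Galois category, and its fundamental group is isomorphic, as a topological group, to $$\mathbf{VK}\bigl(\pi_1(\mathcal C,F),\pi_1(\mathcal D,G);\pi_1(\mathcal E_1,H_1),\dots,\pi_1(\mathcal E_s,H_s)\bigr)_{(\psi_1,\dots,\psi_s),(\phi_1,\dots,\phi_s)}.$$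 -/

import Mathlib

open CategoryTheory CategoryTheory.Limits

universe w v v₁ v₂ u u₁ u₂

noncomputable section

namespace VanKampen

section FundamentalGroup

variable {C : Type u₁} [Category.{v₁} C] (F : C ⥤ Type w)

/-- The family of maps `F X → F X` underlying an automorphism of the set-valued functor `F`. -/
def autAction (σ : Aut F) (X : C) (x : F.obj X) : F.obj X := σ.hom.app X x

/-- The compact-open topology on `Aut F`. Each set `F X` is discrete, so that the compact-open
topology on `Aut (F X)` is the topology of pointwise convergence, and `Aut F` carries the topology
induced by `Aut F ⊆ ∏ X, Aut (F X)`: it is the coarsest topology for which `σ ↦ σ x` is a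
continuous map to the discrete set `F X`, for all objects `X` and all `x` in `F X`. -/
instance autTopology : TopologicalSpace (Aut F) :=
  ⨅ (X : C) (x : F.obj X), TopologicalSpace.induced (fun σ : Aut F => autAction F σ X x) ⊥

variable {F}

lemma autAction_mul (σ τ : Aut F) (X : C) (x : F.obj X) :
    autAction F (σ * τ) X x = autAction F σ X (autAction F τ X x) := rfl

lemma autAction_inv_eq_iff (σ : Aut F) (X : C) (x y : F.obj X) :
    autAction F σ⁻¹ X x = y ↔ autAction F σ X y = x := by
  have h₁ : ∀ z, autAction F σ⁻¹ X (autAction F σ X z) = z := fun z => by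
    rw [← autAction_mul, inv_mul_cancel]; rfl
  have h₂ : ∀ z, autAction F σ X (autAction F σ⁻¹ X z) = z := fun z => by
    rw [← autAction_mul, mul_inv_cancel]; rfl
  constructor
  · rintro rfl; exact h₂ x
  · rintro rfl; exact h₁ y

lemma isOpen_setOf_autAction (X : C) (x y : F.obj X) :
    IsOpen {σ : Aut F | autAction F σ X x = y} := by
  have h : autTopology F ≤ TopologicalSpace.induced (fun σ : Aut F => autAction F σ X x) ⊥ :=
    iInf₂_le X x
  exact h _ ⟨{y}, trivial, rfl⟩

lemma continuous_aut_iff {T : Type*} [TopologicalSpace T] (f : T → Aut F) :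
    Continuous f ↔ ∀ (X : C) (x y : F.obj X), IsOpen {t | autAction F (f t) X x = y} := by
  constructor
  · exact fun hf X x y => (isOpen_setOf_autAction X x y).preimage hf
  · intro h
    refine continuous_iInf_rng.2 fun X => continuous_iInf_rng.2 fun x => continuous_induced_rng.2 ?_
    let _ : TopologicalSpace (F.obj X) := ⊥
    have _ : DiscreteTopology (F.obj X) := ⟨rfl⟩
    exact continuous_discrete_rng.2 fun y => h X x y

instance : IsTopologicalGroup (Aut F) where
  continuous_mul := by
    rw [continuous_aut_iff]
    intro X x y
    have : {p : Aut F × Aut F | autAction F (p.1 * p.2) X x = y} =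
        ⋃ z, {σ | autAction F σ X z = y} ×ˢ {τ | autAction F τ X x = z} := by
      ext p
      simp [autAction_mul]
    rw [this]
    exact isOpen_iUnion fun z =>
      (isOpen_setOf_autAction X z y).prod (isOpen_setOf_autAction X x z)
  continuous_inv := by
    rw [continuous_aut_iff]
    intro X x y
    simp only [autAction_inv_eq_iff]
    exact isOpen_setOf_autAction X y x

end FundamentalGroup

section InfiniteGalois

variable {C : Type u₁} [Category.{v₁} C]

/-- The pair `(C, F)` is an infinite Galois category. Sets are the elements of `Type w`; the
connected objects are the non-initial objects `X` such that every monomorphism `Y ⟶ X` with `Y`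
not initial is an isomorphism. -/
structure IsInfiniteGalois (F : C ⥤ Type w) : Prop where
  hasColimits : HasColimitsOfSize.{w, w} C
  hasFiniteLimits : HasFiniteLimits C
  /-- Every object is a coproduct of connected objects. -/
  exists_decomposition (X : C) : ∃ (ι : Type w) (Y : ι → C) (c : Cofan Y),
    (∀ i, PreGaloisCategory.IsConnected (Y i)) ∧ Nonempty (IsColimit c) ∧ Nonempty (c.pt ≅ X)
  /-- A set of connected objects generates `C` under (small) colimits. -/
  exists_generators : ∃ (ι : Type w) (S : ι → C),
    (∀ i, PreGaloisCategory.IsConnected (S i)) ∧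
    (ObjectProperty.ofObj S).colimitsClosure (fun K : Cat.{w, w} => (K : Type w)) = ⊤
  faithful : F.Faithful
  reflectsIsomorphisms : F.ReflectsIsomorphisms
  preservesColimits : PreservesColimitsOfSize.{w, w} F
  preservesFiniteLimits : PreservesFiniteLimits F

/-- The pair `(C, F)` is a tame infinite Galois category: the fundamental group `Aut F` acts
transitively on `F X` for each connected object `X`. -/
structure IsTameInfiniteGalois (F : C ⥤ Type w) : Prop extends IsInfiniteGalois F where
  transitive (X : C) (hX : PreGaloisCategory.IsConnected X) (x y : F.obj X) :
    ∃ σ : Aut F, σ.hom.app X x = y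

variable {E : Type u₂} [Category.{v₂} E]

/-- Given a functor `t : C ⥤ E`, set-valued functors `H` on `E` and `F` on `C`, and an isomorphism
`α : t ⋙ H ≅ F`, the continuous homomorphism `Aut H → Aut (t ⋙ H) → Aut F`: whiskering with `t`,
followed by conjugation with `α`. -/
def pi1Map {F : C ⥤ Type w} {H : E ⥤ Type w} (t : C ⥤ E) (α : t ⋙ H ≅ F) : Aut H →ₜ* Aut F :=
  { (MonoidHom.mk' (fun σ : Aut H => (α.symm ≪≫ Functor.isoWhiskerLeft t σ ≪≫ α : F ≅ F))
      (fun σ τ : H ≅ H => by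
        change α.symm ≪≫ Functor.isoWhiskerLeft t (τ ≪≫ σ) ≪≫ α =
          (α.symm ≪≫ Functor.isoWhiskerLeft t τ ≪≫ α) ≪≫
            (α.symm ≪≫ Functor.isoWhiskerLeft t σ ≪≫ α)
        ext X x
        simp) : Aut H →* Aut F) with
    continuous_toFun := (continuous_aut_iff _).2 fun X x y => by
      have h : ∀ σ : Aut H, α.hom.app X (autAction H σ (t.obj X) (α.inv.app X x)) = y ↔
          autAction H σ (t.obj X) (α.inv.app X x) = α.inv.app X y := fun σ => by
        constructor
        · rintro rfl; simp
        · intro h'; rw [h']; simp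
      change IsOpen {σ : Aut H | α.hom.app X (autAction H σ (t.obj X) (α.inv.app X x)) = y}
      simp only [h]
      exact isOpen_setOf_autAction _ _ _ }

end InfiniteGalois

section GSets

variable (G : Type u₁) [Group G] [TopologicalSpace G] (H : Type u₂) [Group H] [TopologicalSpace H]

/-- A discrete set in `Type w` with a continuous action of the topological group `G`. -/
structure GSet where
  carrier : Type w
  [action : MulAction G carrier]
  continuous : @ContinuousSMul G carrier _ _ ⊥

/-- A discrete set in `Type w` with two continuous actions, one of `G` and one of `H` (with no
compatibility between them). -/
structure BiSet where
  carrier : Type w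
  [actionLeft : MulAction G carrier]
  [actionRight : MulAction H carrier]
  continuousLeft : @ContinuousSMul G carrier _ _ ⊥
  continuousRight : @ContinuousSMul H carrier _ _ ⊥

attribute [instance] GSet.action BiSet.actionLeft BiSet.actionRight

/-- The morphisms of `G`-sets are the equivariant maps. -/
instance : Category (GSet.{w} G) where
  Hom X Y := {f : X.carrier → Y.carrier // ∀ (g : G) (x : X.carrier), f (g • x) = g • f x}
  id _ := ⟨id, fun _ _ => rfl⟩
  comp f f' := ⟨f'.1 ∘ f.1, fun g x => by simp [f.2, f'.2]⟩

/-- The morphisms are the maps that are equivariant for both actions. -/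
instance : Category (BiSet.{w} G H) where
  Hom X Y := {f : X.carrier → Y.carrier //
    (∀ (g : G) (x : X.carrier), f (g • x) = g • f x) ∧
    (∀ (h : H) (x : X.carrier), f (h • x) = h • f x)}
  id _ := ⟨id, fun _ _ => rfl, fun _ _ => rfl⟩
  comp f f' := ⟨f'.1 ∘ f.1, fun g x => by simp [f.2.1, f'.2.1], fun h x => by simp [f.2.2, f'.2.2]⟩

/-- The forgetful functor from `G`-sets to sets. -/
def GSet.forget : GSet.{w} G ⥤ Type w where
  obj X := X.carrier
  map f := TypeCat.ofHom f.1

/-- The forgetful functor from sets with two actions to sets. -/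
def BiSet.forget : BiSet.{w} G H ⥤ Type w where
  obj X := X.carrier
  map f := TypeCat.ofHom f.1

/-- The Noohi completion of a topological group `G`: the automorphism group of the forgetful
functor on `G`-sets, with the compact-open topology. -/
abbrev NoohiCompletion : Type (max u₁ (w + 1)) := Aut (GSet.forget.{w} G)

/-- The Noohi quotient of `G` by a set `R` of elements: the Noohi completion of the quotient of `G`
by the normal subgroup generated by `R`. -/
abbrev NoohiQuotient (R : Set G) : Type (max u₁ (w + 1)) :=
  NoohiCompletion.{w} (G ⧸ Subgroup.normalClosure R)

/-- The coproduct of `G` and `H` in the category of Noohi groups: the fundamental group of the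
infinite Galois category of discrete sets with continuous actions of `G` and of `H`. -/
abbrev NoohiCoprod : Type (max u₁ u₂ (w + 1)) := Aut (BiSet.forget.{w} G H)

variable {G H}

private lemma isOpen_smul_eq {S : Type w} [MulAction G S] (hS : @ContinuousSMul G S _ _ ⊥)
    (x y : S) : IsOpen {g : G | g • x = y} := by
  let _ : TopologicalSpace S := ⊥
  have _ : DiscreteTopology S := ⟨rfl⟩
  have _ : ContinuousSMul G S := hS
  exact (isOpen_discrete {y}).preimage (continuous_id.smul continuous_const : Continuous
    fun g : G => g • x)

/-- The structure map `G → NoohiCoprod G H`: the element `g` acts on every set with two actions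
through the first one. -/
def NoohiCoprod.inl : G →ₜ* NoohiCoprod.{w} G H :=
  { (MonoidHom.mk' (fun g : G => (NatIso.ofComponents
        (fun X : BiSet.{w} G H => (MulAction.toPerm g : Equiv.Perm X.carrier).toIso)
        (fun f => by ext x; exact (f.2.1 g x).symm) : BiSet.forget.{w} G H ≅ BiSet.forget G H))
      (fun g g' => by
        apply Iso.ext
        ext X x
        exact mul_smul g g' (show X.carrier from x)) : G →* NoohiCoprod.{w} G H) with
    continuous_toFun := (continuous_aut_iff _).2 fun X x y =>
      isOpen_smul_eq X.continuousLeft x y }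

/-- The structure map `H → NoohiCoprod G H`: the element `h` acts on every set with two actions
through the second one. -/
def NoohiCoprod.inr : H →ₜ* NoohiCoprod.{w} G H :=
  { (MonoidHom.mk' (fun h : H => (NatIso.ofComponents
        (fun X : BiSet.{w} G H => (MulAction.toPerm h : Equiv.Perm X.carrier).toIso)
        (fun f => by ext x; exact (f.2.2 h x).symm) : BiSet.forget.{w} G H ≅ BiSet.forget G H))
      (fun h h' => by
        apply Iso.ext
        ext X x
        exact mul_smul h h' (show X.carrier from x)) : H →* NoohiCoprod.{w} G H) with
    continuous_toFun := (continuous_aut_iff _).2 fun X x y =>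
      isOpen_smul_eq X.continuousRight x y }

end GSets

section VK

/-- The group with generators `u i j` and relations `u i i = 1`, `u i j * u j k = u i k`, where
`i`, `j`, `k` run through `s` indices. It is free of rank `s - 1`. -/
def PathGroup (s : ℕ) : Type :=
  PresentedGroup
    ({r | ∃ i : Fin s, r = FreeGroup.of (i, i)} ∪
      {r | ∃ i j k : Fin s,
        r = FreeGroup.of (i, j) * FreeGroup.of (j, k) * (FreeGroup.of (i, k))⁻¹} :
      Set (FreeGroup (Fin s × Fin s)))

instance (s : ℕ) : Group (PathGroup s) := by unfold PathGroup; infer_instance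

/-- The group `PathGroup s` is a discrete topological group. -/
instance (s : ℕ) : TopologicalSpace (PathGroup s) := ⊥

instance (s : ℕ) : DiscreteTopology (PathGroup s) := ⟨rfl⟩

/-- The generator `u i j`. -/
def PathGroup.u {s : ℕ} (i j : Fin s) : PathGroup s := PresentedGroup.of (i, j)

/-- The generators `v j = u 1 j`, the first index being `0 : Fin s`; in particular `v 1 = 1`. -/
def PathGroup.v {s : ℕ} [NeZero s] (j : Fin s) : PathGroup s := PathGroup.u 0 j

variable {P : Type u₁} [Group P] [TopologicalSpace P] {P' : Type u₂} [Group P'] [TopologicalSpace P']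
  {s : ℕ} [NeZero s] {Q : Fin s → Type u} [∀ i, Group (Q i)] [∀ i, TopologicalSpace (Q i)]
  (ψ : ∀ i, Q i →ₜ* P) (φ : ∀ i, Q i →ₜ* P')

/-- The elements `ψ i a ⁻¹ * (v i ⁻¹ * φ i a * v i)` of the Noohi coproduct of `P` with the Noohi
coproduct of `P'` and `PathGroup s`. -/
def vkRelators : Set (NoohiCoprod.{w} P (NoohiCoprod.{w} P' (PathGroup s))) :=
  {r | ∃ (i : Fin s) (a : Q i),
    r = (NoohiCoprod.inl (ψ i a))⁻¹ *
      NoohiCoprod.inr ((NoohiCoprod.inr (PathGroup.v i))⁻¹ * NoohiCoprod.inl (φ i a) *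
        NoohiCoprod.inr (PathGroup.v i))}

/-- The van Kampen Noohi group `VK(P, P'; Q 1, …, Q s)`: the Noohi quotient of the Noohi coproduct
of `P`, `P'` and `PathGroup s` by the relations `ψ i a = v i ⁻¹ * φ i a * v i`, for all `i` and all
`a` in `Q i`. -/
abbrev VK : Type (max u₁ u₂ (w + 1)) :=
  NoohiQuotient.{w} (NoohiCoprod.{w} P (NoohiCoprod.{w} P' (PathGroup s))) (vkRelators.{w} ψ φ)

end VK

section FibreProduct

variable {C : Type u₁} [Category.{v₁} C] {D : Type u₂} [Category.{v₂} D]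
  {s : ℕ} {E : Fin s → Type u} [∀ j, Category.{v} (E j)]
  (t : ∀ j, C ⥤ E j) (t' : ∀ j, D ⥤ E j)

/-- The 2-fibre product of `C` and `D` over the product of the categories `E j`: the objects are
triples `(X, Y, e)` with `X` in `C`, `Y` in `D` and `e` an isomorphism
`(t j X)_j ≅ (t' j Y)_j` in the product category. -/
abbrev FibreProduct := CategoricalPullback (Functor.pi' t) (Functor.pi' t')

/-- The functor `(X, Y, e) ↦ F X` on the 2-fibre product. -/
def fibreProductFunctor (F : C ⥤ Type w) : FibreProduct t t' ⥤ Type w :=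
  CategoricalPullback.π₁ (Functor.pi' t) (Functor.pi' t') ⋙ F

end FibreProduct

end VanKampen

end

/-! A tame infinite Galois category is the category of discrete sets with a continuous action of its
fundamental group (`isEquivalence_fibreGSet`). By transitivity a stable subset of a fibre is a union
of fibres of connected components, hence comes from a subobject. So equivariant maps are recovered
from their graphs, and every continuous set is a quotient of some fibre by such a subobject.
Conversely, the continuous sets of a topological group that is small in the universe of sets form a
tame infinite Galois category (`isTameInfiniteGalois_of_isEquivalence`). It is therefore enough to
find one group whose continuous sets are the objects of the 2-fibre product.

That group is `VKGroup`, the quotient inside `VK` before the last Noohi completion. A triple in the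
2-fibre product amounts to an `Aut F`-set, an `Aut G`-set and bijections `e j` between them that
intertwine the actions of `Aut (H j)`. Carry everything to the first set along `e 0`, and let the
path `v j` act as the inverse of `e 0` after `e j`. The intertwining condition then becomes exactly
the van Kampen relation. In the other direction, restrict a `VKGroup`-set to `Aut F` and to `Aut G`;
by the relations the action of `v j` is `Aut (H j)`-equivariant, so it lifts to an isomorphism in `E
j`. This is `isEquivalence_glueFunctor`.

Two facts control the Noohi coproduct: the abstract free product is dense in it
(`exists_inv_mul_mem`), so equivariance can be tested on the factors, and it is small if the factors
are. The equivalence respects the functors to sets, so it identifies the fundamental group with the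
automorphism group of the forgetful functor on `VKGroup`-sets, which is `VK` by definition. -/

noncomputable section

namespace VanKampen

/-! ### Colimits and finite limits of continuous `T`-sets -/

namespace GSet

variable {T : Type u₁} [Group T] [TopologicalSpace T]

lemma isOpen_setOf_smul_eq (X : GSet.{w} T) (x y : X.carrier) : IsOpen {g : T | g • x = y} := by
  let _ : TopologicalSpace X.carrier := ⊥
  have _ : DiscreteTopology X.carrier := ⟨rfl⟩
  have _ : ContinuousSMul T X.carrier := X.continuous
  exact (isOpen_discrete {y}).preimage
    (continuous_id.smul continuous_const : Continuous fun g : T => g • x)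

/-- Over a discrete set, the preimage of a point under the action map is a union of products of a
transporter with a point. Open transporters are the form in which continuity is checked for every
set constructed below. -/
lemma continuousSMul_bot_of_isOpen {S : Type w} [MulAction T S]
    (h : ∀ x y : S, IsOpen {g : T | g • x = y}) : @ContinuousSMul T S _ _ ⊥ := by
  let _ : TopologicalSpace S := ⊥
  have _ : DiscreteTopology S := ⟨rfl⟩
  refine ⟨continuous_discrete_rng.2 fun y => ?_⟩
  have : (fun p : T × S => p.1 • p.2) ⁻¹' {y} = ⋃ x : S, {g : T | g • x = y} ×ˢ {x} := by
    ext ⟨g, x⟩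
    simp
  rw [this]
  exact isOpen_iUnion fun x => (h x y).prod (isOpen_discrete _)

/-- The `T`-set given by a homomorphism to a permutation group for which the transporters are
open. -/
def ofHom {S : Type w} (ρ : T →* Equiv.Perm S) (hρ : ∀ x y, IsOpen {g | ρ g x = y}) :
    GSet.{w} T :=
  letI : MulAction T S := MulAction.compHom S ρ
  { carrier := S
    continuous := continuousSMul_bot_of_isOpen hρ }

/-- The morphism of `T`-sets given by an equivariant map. -/
def homMk {X Y : GSet.{w} T} (f : X.carrier → Y.carrier) (hf : ∀ (g : T) x, f (g • x) = g • f x) :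
    X ⟶ Y := ⟨f, hf⟩

lemma hom_ext {X Y : GSet.{w} T} {f f' : X ⟶ Y} (h : ∀ x, f.1 x = f'.1 x) : f = f' :=
  Subtype.ext (funext h)

lemma isIso_of_bijective {X Y : GSet.{w} T} (f : X ⟶ Y) (hf : Function.Bijective f.1) :
    IsIso f := by
  let e := Equiv.ofBijective f.1 hf
  refine ⟨homMk e.symm fun g y => ?_, hom_ext fun x => e.symm_apply_apply x,
    hom_ext fun y => e.apply_symm_apply y⟩
  apply e.injective
  rw [e.apply_symm_apply]
  have := f.2 g (e.symm y)
  exact (this.trans (congrArg (g • ·) (e.apply_symm_apply y))).symm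

instance : (forget.{w} T).Faithful where
  map_injective {_ _ _ _} h := hom_ext fun x => ConcreteCategory.congr_hom h x

instance : (forget.{w} T).ReflectsIsomorphisms where
  reflects f hf := isIso_of_bijective f ((isIso_iff_bijective _).1 hf)

section Colimits

variable {J : Type u₂} [Category.{v₂} J] (D : J ⥤ GSet.{w} T) {c : Cocone (D ⋙ forget T)}
  (hc : IsColimit c)

/-- The action of `g` on a colimit of the underlying sets. -/
def colimitSMul (g : T) : c.pt ⟶ c.pt :=
  hc.desc
    { pt := c.pt
      ι :=
        { app := fun j => TypeCat.ofHom (fun x : (D.obj j).carrier => c.ι.app j (g • x))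
          naturality := fun j j' f => by
            ext x
            have h := ConcreteCategory.congr_hom (c.w f) (g • (show (D.obj j).carrier from x))
            refine Eq.trans (congrArg (c.ι.app j') ?_) h
            exact ((D.map f).2 g x).symm } }

lemma colimitSMul_ι (g : T) (j : J) (x : (D.obj j).carrier) :
    colimitSMul D hc g (c.ι.app j x) = c.ι.app j (g • x) :=
  ConcreteCategory.congr_hom (hc.fac _ j) x

include hc in
lemma exists_colimit_rep (y : c.pt) : ∃ (j : J) (x : (D.obj j).carrier), c.ι.app j x = y :=
  Types.jointly_surjective_of_isColimit hc y

/-- The action on a colimit of the underlying sets. -/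
def colimitHom : T →* Equiv.Perm c.pt where
  toFun g :=
    { toFun := colimitSMul D hc g
      invFun := colimitSMul D hc g⁻¹
      left_inv := fun y => by
        obtain ⟨j, x, rfl⟩ := exists_colimit_rep D hc y
        rw [colimitSMul_ι, colimitSMul_ι, inv_smul_smul]
      right_inv := fun y => by
        obtain ⟨j, x, rfl⟩ := exists_colimit_rep D hc y
        rw [colimitSMul_ι, colimitSMul_ι, smul_inv_smul] }
  map_one' := by
    ext y
    obtain ⟨j, x, rfl⟩ := exists_colimit_rep D hc y
    exact (colimitSMul_ι D hc 1 j x).trans (by rw [one_smul]; rfl)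
  map_mul' g h := by
    ext y
    obtain ⟨j, x, rfl⟩ := exists_colimit_rep D hc y
    refine (colimitSMul_ι D hc _ j x).trans ?_
    change _ = colimitSMul D hc g (colimitSMul D hc h _)
    rw [colimitSMul_ι, colimitSMul_ι, mul_smul]

/-- The colimit cocone of `T`-sets on a colimit of the underlying sets. -/
def colimitCocone : Cocone D where
  pt := ofHom (colimitHom D hc) fun y z => by
    obtain ⟨j, x, rfl⟩ := exists_colimit_rep D hc y
    have : {g | colimitHom D hc g (c.ι.app j x) = z} =
        ⋃ x' : {x' // c.ι.app j x' = z}, {g : T | g • x = x'.1} := by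
      ext g
      have : colimitHom D hc g (c.ι.app j x) = c.ι.app j (g • x) := colimitSMul_ι D hc g j x
      simp only [Set.mem_ofPred_eq, this, Set.mem_iUnion, Subtype.exists, exists_prop]
      exact ⟨fun h => ⟨_, h, rfl⟩, fun ⟨_, h, h'⟩ => h' ▸ h⟩
    rw [this]
    exact isOpen_iUnion fun _ => isOpen_setOf_smul_eq _ _ _
  ι :=
    { app := fun j => homMk (fun x => c.ι.app j x) fun g x => (colimitSMul_ι D hc g j x).symm
      naturality := fun j j' f => hom_ext fun x => ConcreteCategory.congr_hom (c.w f) x }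

/-- The cocone `colimitCocone` is a colimit. -/
def isColimitColimitCocone : IsColimit (colimitCocone D hc) where
  desc s := homMk (fun y => hc.desc ((forget T).mapCocone s) y) fun g y => by
    obtain ⟨j, x, rfl⟩ := exists_colimit_rep D hc y
    refine (congrArg (hc.desc ((forget T).mapCocone s)) (colimitSMul_ι D hc g j x)).trans ?_
    have h := fun x => ConcreteCategory.congr_hom (hc.fac ((forget T).mapCocone s) j) x
    refine (h _).trans (((s.ι.app j).2 g x).trans ?_)
    exact congrArg (g • ·) (h x).symm
  fac s j := hom_ext fun x => ConcreteCategory.congr_hom (hc.fac ((forget T).mapCocone s) j) x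
  uniq s m hm := by
    apply (forget T).map_injective
    exact hc.hom_ext fun j => (congrArg (forget T).map (hm j)).trans (hc.fac ((forget T).mapCocone s) j).symm

end Colimits

section Limits

variable {J : Type u₂} [Category.{v₂} J] (D : J ⥤ GSet.{w} T) {c : Cone (D ⋙ forget T)}
  (hc : IsLimit c)

variable (c) in
/-- The projection from a limit of the underlying sets, as a map to the `T`-set `D j`. -/
def limitProj (j : J) (x : c.pt) : (D.obj j).carrier := c.π.app j x

/-- The action of `g` on a limit of the underlying sets. -/
def limitSMul (g : T) : c.pt ⟶ c.pt :=
  hc.lift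
    { pt := c.pt
      π :=
        { app := fun j => TypeCat.ofHom (fun x => g • limitProj D c j x)
          naturality := fun j j' f => by
            ext x
            have h := ConcreteCategory.congr_hom (c.w f) x
            refine Eq.trans (congrArg (g • ·) h.symm) ?_
            exact ((D.map f).2 g _).symm } }

lemma π_limitSMul (g : T) (j : J) (x : c.pt) :
    limitProj D c j (limitSMul D hc g x) = g • limitProj D c j x :=
  ConcreteCategory.congr_hom (hc.fac
    { pt := c.pt
      π :=
        { app := fun j => TypeCat.ofHom (fun x => g • limitProj D c j x)
          naturality := _ } } j) x

include hc in
lemma limit_ext {x y : c.pt} (h : ∀ j, limitProj D c j x = limitProj D c j y) : x = y := by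
  have : (TypeCat.ofHom fun _ : PUnit => x) = TypeCat.ofHom fun _ : PUnit => y :=
    hc.hom_ext fun j => by ext; exact h j
  exact ConcreteCategory.congr_hom this PUnit.unit

/-- The action on a limit of the underlying sets. -/
def limitHom : T →* Equiv.Perm c.pt where
  toFun g :=
    { toFun := limitSMul D hc g
      invFun := limitSMul D hc g⁻¹
      left_inv := fun y => limit_ext D hc fun j => by
        rw [π_limitSMul, π_limitSMul]; exact inv_smul_smul _ _
      right_inv := fun y => limit_ext D hc fun j => by
        rw [π_limitSMul, π_limitSMul]; exact smul_inv_smul _ _ }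
  map_one' := by
    ext y
    exact limit_ext D hc fun j => (π_limitSMul D hc 1 j y).trans (one_smul T _)
  map_mul' g h := by
    ext y
    refine limit_ext D hc fun j => (π_limitSMul D hc _ j y).trans ?_
    change _ = limitProj D c j (limitSMul D hc g (limitSMul D hc h _))
    rw [π_limitSMul, π_limitSMul, mul_smul]

/-- The limit cone of `T`-sets on a finite limit of the underlying sets. -/
def limitCone [Finite J] : Cone D where
  pt := ofHom (limitHom D hc) fun y z => by
    have : {g | limitHom D hc g y = z} = ⋂ j : J,
        {g : T | g • limitProj D c j y = limitProj D c j z} := by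
      ext g
      have : ∀ j, limitProj D c j (limitHom D hc g y) =
        g • limitProj D c j y := fun j => π_limitSMul D hc g j y
      simp only [Set.mem_ofPred_eq, Set.mem_iInter, ← this]
      exact ⟨fun h j => by rw [h], fun h => limit_ext D hc h⟩
    rw [this]
    -- Finiteness of `J` is essential here: an infinite product of continuous discrete `T`-sets need
    -- not be continuous.
    exact isOpen_iInter_of_finite fun j => isOpen_setOf_smul_eq _ _ _
  π :=
    { app := fun j => homMk (fun x => c.π.app j x) fun g x => π_limitSMul D hc g j x
      naturality := fun j j' f => hom_ext fun x => ConcreteCategory.congr_hom (c.w f).symm x }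

/-- The cone `limitCone` is a limit. -/
def isLimitLimitCone [Finite J] : IsLimit (limitCone D hc) where
  lift s := homMk (fun y => hc.lift ((forget T).mapCone s) y) fun g y => by
    have h := fun j x => ConcreteCategory.congr_hom (hc.fac ((forget T).mapCone s) j) x
    refine limit_ext D hc fun j => (h j _).trans (((s.π.app j).2 g y).trans ?_)
    refine Eq.trans ?_ (π_limitSMul D hc g j _).symm
    exact congrArg (g • ·) (h j y).symm
  fac s j := hom_ext fun x => ConcreteCategory.congr_hom (hc.fac ((forget T).mapCone s) j) x
  uniq s m hm := by
    apply (forget T).map_injective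
    exact hc.hom_ext fun j => (congrArg (forget T).map (hm j)).trans (hc.fac ((forget T).mapCone s) j).symm

end Limits

instance : HasColimitsOfSize.{w, w} (GSet.{w} T) where
  has_colimits_of_shape _ _ :=
    { has_colimit := fun D =>
        ⟨⟨⟨_, isColimitColimitCocone D (colimit.isColimit (D ⋙ forget T))⟩⟩⟩ }

instance : PreservesColimitsOfSize.{w, w} (forget.{w} T) where
  preservesColimitsOfShape :=
    { preservesColimit := fun {D} =>
        preservesColimit_of_preserves_colimit_cocone
          (isColimitColimitCocone D (colimit.isColimit (D ⋙ forget T)))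
          (IsColimit.ofIsoColimit (colimit.isColimit (D ⋙ forget T))
            (Cocone.ext (Iso.refl _) fun j => by ext; rfl)) }

instance : HasFiniteLimits (GSet.{w} T) where
  out _ _ _ :=
    { has_limit := fun D =>
        ⟨⟨⟨_, isLimitLimitCone D (limit.isLimit (D ⋙ forget T))⟩⟩⟩ }

instance : PreservesFiniteLimits (forget.{w} T) where
  preservesFiniteLimits _ _ _ :=
    { preservesLimit := fun {D} =>
        preservesLimit_of_preserves_limit_cone
          (isLimitLimitCone D (limit.isLimit (D ⋙ forget T)))
          (IsLimit.ofIsoLimit (limit.isLimit (D ⋙ forget T))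
            (Cone.ext (Iso.refl _) fun j => by ext; rfl)) }

end GSet

/-! ### Orbits, connected `T`-sets and coset spaces -/

namespace GSet

variable {T : Type u₁} [Group T] [TopologicalSpace T]

/-- The `T`-set underlying a `T`-stable subset. -/
def ofSubset (X : GSet.{w} T) (A : Set X.carrier) (hA : ∀ (g : T), ∀ x ∈ A, g • x ∈ A) :
    GSet.{w} T :=
  letI : MulAction T A :=
    { smul := fun g x => ⟨g • x.1, hA g _ x.2⟩
      one_smul := fun x => Subtype.ext (one_smul T x.1)
      mul_smul := fun g h x => Subtype.ext (mul_smul g h x.1) }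
  { carrier := A
    continuous := continuousSMul_bot_of_isOpen fun x y => by
      convert isOpen_setOf_smul_eq X x.1 y.1 using 1
      ext g
      exact Subtype.ext_iff }

/-- The inclusion of a `T`-stable subset. -/
def subsetIncl (X : GSet.{w} T) (A : Set X.carrier) (hA : ∀ (g : T), ∀ x ∈ A, g • x ∈ A) :
    ofSubset X A hA ⟶ X :=
  homMk (fun x => x.1) fun _ _ => rfl

/-- An empty `T`-set is initial. -/
def isInitialOfIsEmpty (X : GSet.{w} T) [IsEmpty X.carrier] : IsInitial X :=
  IsInitial.ofUniqueHom (fun _ => homMk isEmptyElim fun _ x => isEmptyElim x)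
    fun _ _ => hom_ext fun x => isEmptyElim x

/-- The empty `T`-set. -/
def empty : GSet.{w} T :=
  ofHom (S := PEmpty) 1 fun x => x.elim

lemma injective_of_mono {X Y : GSet.{w} T} (f : X ⟶ Y) [Mono f] : Function.Injective f.1 :=
  (mono_iff_injective ((forget T).map f)).1 inferInstance

/-- An orbit is a non-initial subobject, so connectedness forces it to be everything; conversely, a
nonempty stable subset of a transitive set is the whole set. -/
lemma isConnected_iff (X : GSet.{w} T) : PreGaloisCategory.IsConnected X ↔
    Nonempty X.carrier ∧ ∀ x y : X.carrier, ∃ g : T, g • x = y := by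
  constructor
  · intro hX
    refine ⟨?_, fun x y => ?_⟩
    · by_contra h
      have := not_nonempty_iff.1 h
      exact hX.notInitial (isInitialOfIsEmpty X)
    · let i := subsetIncl X (MulAction.orbit T x) fun g y hy => by
        obtain ⟨h, rfl⟩ := hy
        exact ⟨g * h, mul_smul _ _ _⟩
      have : Mono i := (forget T).mono_of_mono_map
        ((mono_iff_injective _).2 fun a b h => Subtype.ext h)
      have hi : IsIso i := hX.noTrivialComponent _ i fun h =>
        ((h.to (empty : GSet.{w} T)).1 ⟨x, MulAction.mem_orbit_self x⟩).elim
      obtain ⟨⟨_, g, rfl⟩, hg⟩ := ((isIso_iff_bijective ((forget T).map i)).1 inferInstance).2 y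
      exact ⟨g, hg⟩
  · rintro ⟨⟨x⟩, h⟩
    refine ⟨fun hX => ((hX.to (empty : GSet.{w} T)).1 x).elim, fun Y i _ hY => ?_⟩
    refine isIso_of_bijective i ⟨injective_of_mono i, fun z => ?_⟩
    have : Nonempty Y.carrier := by
      by_contra h
      have := not_nonempty_iff.1 h
      exact hY (isInitialOfIsEmpty Y)
    obtain ⟨y⟩ := this
    obtain ⟨g, hg⟩ := h (i.1 y) z
    exact ⟨g • y, (i.2 g y).trans hg⟩

lemma smul_mem_orbitRel {X : GSet.{w} T} (q : MulAction.orbitRel.Quotient T X.carrier) (g : T)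
    (x : X.carrier) (hx : x ∈ {x | Quotient.mk (MulAction.orbitRel T X.carrier) x = q}) :
    g • x ∈ {x | Quotient.mk (MulAction.orbitRel T X.carrier) x = q} :=
  Eq.trans (Quotient.sound ⟨g, rfl⟩) hx

/-- The orbit of a `T`-set, as a `T`-set. -/
def orbitObj (X : GSet.{w} T) (q : MulAction.orbitRel.Quotient T X.carrier) : GSet.{w} T :=
  ofSubset X _ (smul_mem_orbitRel q)

lemma isConnected_orbitObj (X : GSet.{w} T) (q : MulAction.orbitRel.Quotient T X.carrier) :
    PreGaloisCategory.IsConnected (orbitObj X q) := by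
  refine (isConnected_iff _).2 ⟨?_, ?_⟩
  · obtain ⟨x, rfl⟩ := Quotient.exists_rep q
    exact ⟨⟨x, rfl⟩⟩
  · rintro ⟨x, rfl⟩ ⟨y, hy⟩
    obtain ⟨g, hg⟩ := Quotient.exact hy
    exact ⟨g, Subtype.ext hg⟩

/-- A `T`-set as a cofan on its orbits. -/
def orbitCofan (X : GSet.{w} T) : Cofan (orbitObj X) :=
  Cofan.mk X fun q => subsetIncl X _ (smul_mem_orbitRel q)

/-- A `T`-set is the coproduct of its orbits. -/
def isColimitOrbitCofan (X : GSet.{w} T) : IsColimit (orbitCofan X) :=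
  Cofan.IsColimit.mk _
    (fun s => homMk (fun x => (s.inj (Quotient.mk _ x)).1 ⟨x, rfl⟩) fun g x => by
      refine Eq.trans ?_ ((s.inj (Quotient.mk _ x)).2 g ⟨x, rfl⟩)
      -- The points `x` and `g • x` have equal but not definitionally equal orbit classes, so the
      -- component maps must be transported.
      have h : ∀ (q q' : MulAction.orbitRel.Quotient T X.carrier) (_ : q = q') (y : X.carrier)
          (hy : Quotient.mk _ y = q) (hy' : Quotient.mk _ y = q'),
          (s.inj q).1 ⟨y, hy⟩ = (s.inj q').1 ⟨y, hy'⟩ := by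
        rintro q _ rfl y _ _
        rfl
      exact h _ _ (Quotient.sound ⟨g, rfl⟩) (g • x) _ _)
    (fun s q => hom_ext fun x => by
      obtain ⟨x, rfl⟩ := x
      rfl)
    (fun s m hm => hom_ext fun x => by
      exact congrArg (fun f => f.1 ⟨x, rfl⟩) (hm (Quotient.mk _ x)))

/-- The transitive `T`-set of cosets of an open subgroup, in the universe `w`. -/
def cosets [IsTopologicalGroup T] [Small.{w} T] (U : {U : Subgroup T // IsOpen (U : Set T)}) :
    GSet.{w} T :=
  have : Small.{w} (T ⧸ U.1) := small_of_surjective Quotient.mk_surjective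
  ofHom ((equivShrink.{w} (T ⧸ U.1)).permCongrHom.toMonoidHom.comp
    (MulAction.toPermHom T (T ⧸ U.1))) fun x y => by
      obtain ⟨x, rfl⟩ := (equivShrink.{w} (T ⧸ U.1)).surjective x
      obtain ⟨y, rfl⟩ := (equivShrink.{w} (T ⧸ U.1)).surjective y
      obtain ⟨a, rfl⟩ := QuotientGroup.mk_surjective x
      obtain ⟨b, rfl⟩ := QuotientGroup.mk_surjective y
      -- The element `g` carries the coset of `a` to that of `b` when `(g * a)⁻¹ * b` lies in `U`,
      -- an open condition on `g`.
      have : {g : T | (a⁻¹ * g⁻¹ * b) ∈ U.1} =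
          {g | ((equivShrink.{w} (T ⧸ U.1)).permCongrHom.toMonoidHom.comp
            (MulAction.toPermHom T (T ⧸ U.1))) g (equivShrink.{w} (T ⧸ U.1) (a : T ⧸ U.1)) =
              equivShrink.{w} (T ⧸ U.1) (b : T ⧸ U.1)} := by
        ext g
        have : ((equivShrink.{w} (T ⧸ U.1)).permCongrHom.toMonoidHom.comp
            (MulAction.toPermHom T (T ⧸ U.1))) g (equivShrink.{w} (T ⧸ U.1) (a : T ⧸ U.1)) =
            equivShrink.{w} (T ⧸ U.1) ((g * a : T) : T ⧸ U.1) := by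
          simp [Equiv.permCongrHom]
        simp only [Set.mem_ofPred_eq, this, EmbeddingLike.apply_eq_iff_eq, QuotientGroup.eq,
          mul_inv_rev]
      rw [← this]
      exact U.2.preimage (by fun_prop : Continuous fun g : T => a⁻¹ * g⁻¹ * b)

lemma cosets_smul [IsTopologicalGroup T] [Small.{w} T] (U : {U : Subgroup T // IsOpen (U : Set T)})
    (g a : T) :
    have : Small.{w} (T ⧸ U.1) := small_of_surjective Quotient.mk_surjective
    (g • (show (cosets.{w} U).carrier from equivShrink.{w} (T ⧸ U.1) (a : T ⧸ U.1)) :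
      (cosets.{w} U).carrier) = equivShrink.{w} (T ⧸ U.1) ((g * a : T) : T ⧸ U.1) := by
  intro _
  change equivShrink.{w} (T ⧸ U.1)
    (g • (equivShrink.{w} (T ⧸ U.1)).symm (equivShrink.{w} (T ⧸ U.1) (a : T ⧸ U.1))) = _
  rw [Equiv.symm_apply_apply]
  rfl

lemma exists_cosets_rep [IsTopologicalGroup T] [Small.{w} T]
    (U : {U : Subgroup T // IsOpen (U : Set T)}) (x : (cosets.{w} U).carrier) :
    have : Small.{w} (T ⧸ U.1) := small_of_surjective Quotient.mk_surjective
    ∃ a : T, equivShrink.{w} (T ⧸ U.1) (a : T ⧸ U.1) = x := by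
  intro _
  obtain ⟨x, rfl⟩ := (equivShrink.{w} (T ⧸ U.1)).surjective x
  obtain ⟨a, rfl⟩ := QuotientGroup.mk_surjective x
  exact ⟨a, rfl⟩

lemma isConnected_cosets [IsTopologicalGroup T] [Small.{w} T]
    (U : {U : Subgroup T // IsOpen (U : Set T)}) :
    PreGaloisCategory.IsConnected (cosets.{w} U) := by
  have : Small.{w} (T ⧸ U.1) := small_of_surjective Quotient.mk_surjective
  refine (isConnected_iff _).2 ⟨⟨equivShrink.{w} (T ⧸ U.1) (1 : T)⟩, fun x y => ?_⟩
  obtain ⟨a, rfl⟩ := exists_cosets_rep U x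
  obtain ⟨b, rfl⟩ := exists_cosets_rep U y
  exact ⟨b * a⁻¹, (cosets_smul U _ a).trans (by rw [inv_mul_cancel_right])⟩

/-- Orbit-stabilizer: the stabilizer of a point is open, and the orbit map from its cosets is
bijective on a transitive set. -/
lemma exists_cosets_iso [IsTopologicalGroup T] [Small.{w} T] (X : GSet.{w} T)
    (hX : PreGaloisCategory.IsConnected X) : ∃ U, Nonempty (cosets.{w} (T := T) U ≅ X) := by
  obtain ⟨⟨x⟩, h⟩ := (isConnected_iff _).1 hX
  let U : {U : Subgroup T // IsOpen (U : Set T)} :=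
    ⟨MulAction.stabilizer T x, isOpen_setOf_smul_eq X x x⟩
  have : Small.{w} (T ⧸ U.1) := small_of_surjective Quotient.mk_surjective
  let f : cosets.{w} U ⟶ X :=
    homMk (fun y => MulAction.ofQuotientStabilizer T x ((equivShrink.{w} (T ⧸ U.1)).symm y))
      fun g y => by
        obtain ⟨a, rfl⟩ := exists_cosets_rep U y
        rw [cosets_smul U g a, Equiv.symm_apply_apply, Equiv.symm_apply_apply]
        exact mul_smul g a x
  have hf : IsIso f := isIso_of_bijective f
    ⟨(MulAction.injective_ofQuotientStabilizer T x).comp (Equiv.injective _), fun y => by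
      obtain ⟨g, rfl⟩ := h x y
      refine ⟨equivShrink.{w} (T ⧸ U.1) (g : T ⧸ U.1), ?_⟩
      exact congrArg (MulAction.ofQuotientStabilizer T x) (Equiv.symm_apply_apply _ _)⟩
  exact ⟨U, ⟨asIso f⟩⟩

variable (T) in
-- The open subgroups of a small group form a small set, and their coset spaces exhaust the
-- connected objects. This supplies the generating set.
lemma exists_small_connected [IsTopologicalGroup T] [Small.{w} T] :
    ∃ (ι : Type w) (S : ι → GSet.{w} T), (∀ i, PreGaloisCategory.IsConnected (S i)) ∧
      ∀ X : GSet.{w} T, PreGaloisCategory.IsConnected X → ∃ i, Nonempty (S i ≅ X) := by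
  have : Small.{w} (Subgroup T) := small_of_injective SetLike.coe_injective
  refine ⟨Shrink.{w} {U : Subgroup T // IsOpen (U : Set T)},
    fun i => cosets ((equivShrink _).symm i), fun i => isConnected_cosets _, fun X hX => ?_⟩
  obtain ⟨U, ⟨e⟩⟩ := exists_cosets_iso X hX
  exact ⟨equivShrink _ U, ⟨eqToIso (congrArg _ (Equiv.symm_apply_apply _ _)) ≪≫ e⟩⟩

end GSet

/-! ### Categories equivalent to a category of continuous sets -/

section Transfer

variable {C : Type u₁} [Category.{v₁} C] {D : Type u₂} [Category.{v₂} D]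

lemma isConnected_obj_of_isEquivalence (e : C ⥤ D) [e.IsEquivalence] (X : C)
    (hX : PreGaloisCategory.IsConnected X) : PreGaloisCategory.IsConnected (e.obj X) := by
  refine ⟨fun h => hX.notInitial (IsInitial.isInitialOfObj e X h), fun Y i _ hY => ?_⟩
  let j : e.objPreimage Y ⟶ X := e.preimage ((e.objObjPreimageIso Y).hom ≫ i)
  have hj : e.map j = (e.objObjPreimageIso Y).hom ≫ i := e.map_preimage _
  have : Mono j := e.mono_of_mono_map (by rw [hj]; infer_instance)
  have : IsIso j := hX.noTrivialComponent _ j fun h =>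
    hY ((IsInitial.isInitialObj e _ h).ofIso (e.objObjPreimageIso Y))
  have : IsIso ((e.objObjPreimageIso Y).hom ≫ i) := hj ▸ inferInstance
  exact IsIso.of_isIso_comp_left (e.objObjPreimageIso Y).hom i

lemma isConnected_of_isConnected_obj (e : C ⥤ D) [e.IsEquivalence] (X : C)
    (hX : PreGaloisCategory.IsConnected (e.obj X)) : PreGaloisCategory.IsConnected X := by
  refine ⟨fun h => hX.notInitial (IsInitial.isInitialObj e X h), fun Y i _ hY => ?_⟩
  have : IsIso (e.map i) := hX.noTrivialComponent _ (e.map i) fun h =>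
    hY (IsInitial.isInitialOfObj e Y h)
  exact isIso_of_reflects_iso i e

lemma isConnected_of_iso {X Y : C} (i : X ≅ Y) (hX : PreGaloisCategory.IsConnected X) :
    PreGaloisCategory.IsConnected Y := by
  refine ⟨fun h => hX.notInitial (h.ofIso i.symm), fun Z j _ hZ => ?_⟩
  have : IsIso (j ≫ i.inv) := hX.noTrivialComponent _ _ hZ
  exact IsIso.of_isIso_comp_right j i.inv

/-- A fully faithful functor reflects coproduct cofans. -/
def isColimitCofanOfMap (e : C ⥤ D) [e.Full] [e.Faithful] {κ : Type w} {Z : κ → D} {c : Cofan Z}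
    (hc : IsColimit c) (Y : κ → C) (f : ∀ a, e.obj (Y a) ≅ Z a) (X : C) (g : e.obj X ≅ c.pt) :
    IsColimit (Cofan.mk X fun a => e.preimage ((f a).hom ≫ c.inj a ≫ g.inv)) :=
  Cofan.IsColimit.mk _
    (fun s => e.preimage (g.hom ≫ Cofan.IsColimit.desc hc fun a => (f a).inv ≫ e.map (s.inj a)))
    (fun s a => e.map_injective (by
      rw [e.map_comp]
      change e.map (e.preimage ((f a).hom ≫ c.inj a ≫ g.inv)) ≫ _ = _
      rw [e.map_preimage, e.map_preimage]
      simp))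
    (fun s m hm => e.map_injective (by
      rw [e.map_preimage, ← Iso.inv_comp_eq]
      refine Cofan.IsColimit.hom_ext hc _ _ fun a => ?_
      rw [Cofan.IsColimit.fac, ← hm a]
      simp [Cofan.inj, Cofan.mk]))

/-- A category with a functor to sets that is equivalent to the category of `T`-sets with its
forgetful functor, for a small topological group `T`, is a tame infinite Galois category. -/
theorem isTameInfiniteGalois_of_isEquivalence {T : Type u} [Group T] [TopologicalSpace T]
    [IsTopologicalGroup T] [Small.{w} T] (e : C ⥤ GSet.{w} T) [e.IsEquivalence]
    (F : C ⥤ Type w) (i : e ⋙ GSet.forget T ≅ F) : IsTameInfiniteGalois F := by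
  have hdec : ∀ X : C, ∃ (ι : Type w) (Y : ι → C) (c : Cofan Y),
      (∀ i, PreGaloisCategory.IsConnected (Y i)) ∧ Nonempty (IsColimit c) ∧
        Nonempty (c.pt ≅ X) := fun X => by
    let q := MulAction.orbitRel.Quotient T (e.obj X).carrier
    let Y : q → C := fun a => e.objPreimage (GSet.orbitObj (e.obj X) a)
    have hY : ∀ a, PreGaloisCategory.IsConnected (Y a) := fun a =>
      isConnected_of_isConnected_obj e _
        (isConnected_of_iso (e.objObjPreimageIso _).symm (GSet.isConnected_orbitObj _ a))
    exact ⟨q, Y, _, hY, ⟨isColimitCofanOfMap e (GSet.isColimitOrbitCofan (e.obj X)) Y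
      (fun a => e.objObjPreimageIso _) X (Iso.refl _)⟩, ⟨Iso.refl _⟩⟩
  exact
    { hasColimits := ⟨fun _ _ => Adjunction.hasColimitsOfShape_of_equivalence e⟩
      hasFiniteLimits := ⟨fun _ _ _ => Adjunction.hasLimitsOfShape_of_equivalence e⟩
      exists_decomposition := hdec
      exists_generators := by
        obtain ⟨ι, S, hS, h⟩ := GSet.exists_small_connected.{w} T
        refine ⟨ι, fun i => e.objPreimage (S i), fun i => isConnected_of_isConnected_obj e _
          (isConnected_of_iso (e.objObjPreimageIso _).symm (hS i)), ?_⟩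
        refine top_unique fun X _ => ?_
        obtain ⟨κ, Y, c, hY, ⟨hc⟩, ⟨f⟩⟩ := hdec X
        refine .of_isoClosure f ?_
        refine ObjectProperty.colimitsClosure.of_colimitPresentation
          (a := Cat.of (Discrete κ)) (X := c.pt) ⟨_, c.ι, hc⟩ fun ⟨k⟩ => ?_
        obtain ⟨i, ⟨g⟩⟩ := h (e.obj (Y k)) (isConnected_obj_of_isEquivalence e _ (hY k))
        exact .of_isoClosure (e.preimageIso (e.objObjPreimageIso _ ≪≫ g)) (.of_mem _ ⟨i⟩)
      faithful := Functor.Faithful.of_iso i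
      reflectsIsomorphisms := reflectsIsomorphisms_of_iso i
      preservesColimits :=
        have : PreservesColimitsOfSize.{w, w} e := inferInstance
        preservesColimits_of_natIso i
      preservesFiniteLimits := preservesFiniteLimits_of_natIso i
      transitive := fun X hX x y => by
        obtain ⟨-, h⟩ := (GSet.isConnected_iff _).1 (isConnected_obj_of_isEquivalence e _ hX)
        obtain ⟨g, hg⟩ := h (i.inv.app X x) (i.inv.app X y)
        -- Every element of `T` acts as an automorphism of the forgetful functor, so transitivity
        -- under `T` gives transitivity under `Aut F`.
        let σ : e ⋙ GSet.forget T ≅ e ⋙ GSet.forget T := NatIso.ofComponents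
          (fun X => (MulAction.toPerm g : Equiv.Perm (e.obj X).carrier).toIso)
          fun f => by ext x; exact ((e.map f).2 g x).symm
        refine ⟨(i.symm ≪≫ σ ≪≫ i : F ≅ F), ?_⟩
        change i.hom.app X (g • (show (e.obj X).carrier from i.inv.app X x)) = y
        erw [hg]
        simp }

end Transfer

/-! ### Neighbourhoods of the identity in `Aut F`, and fibres as `Aut F`-sets -/

section Topology

variable {C : Type u₁} [Category.{v₁} C] {F : C ⥤ Type w}

lemma autAction_one (X : C) (x : F.obj X) : autAction F 1 X x = x := rfl

lemma autAction_map (σ : Aut F) {X Y : C} (f : X ⟶ Y) (x : F.obj X) :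
    autAction F σ Y (F.map f x) = F.map f (autAction F σ X x) :=
  ConcreteCategory.congr_hom (σ.hom.naturality f) x

lemma aut_ext {σ τ : Aut F} (h : ∀ X (x : F.obj X), autAction F σ X x = autAction F τ X x) :
    σ = τ := by
  apply Iso.ext
  ext X x
  exact h X x

variable (F) in
/-- There are points in the sets `F X`, and any two of them are images of a third one. -/
def HasJointPoints : Prop :=
  (∃ X, Nonempty (F.obj X)) ∧ ∀ (X Y : C) (x : F.obj X) (y : F.obj Y),
    ∃ (Z : C) (p : Z ⟶ X) (q : Z ⟶ Y) (z : F.obj Z), F.map p z = x ∧ F.map q z = y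

/-- The filter of neighbourhoods of `1` is the infimum of the principal filters of point
stabilizers. Joint points make this family directed, so a single stabilizer is enough instead of a
finite intersection. -/
lemma HasJointPoints.exists_stabilizer_subset (hF : HasJointPoints F) {U : Set (Aut F)}
    (hU : U ∈ nhds 1) :
    ∃ (X : C) (x : F.obj X), ∀ σ : Aut F, autAction F σ X x = x → σ ∈ U := by
  have h : nhds (1 : Aut F) =
      ⨅ p : Σ X : C, F.obj X, Filter.principal {σ : Aut F | autAction F σ p.1 p.2 = p.2} := by
    rw [iInf_sigma]
    refine nhds_iInf.trans (iInf_congr fun X => nhds_iInf.trans (iInf_congr fun x => ?_))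
    refine (@nhds_induced _ _ ⊥ _ _).trans ?_
    let _ : TopologicalSpace (F.obj X) := ⊥
    have _ : DiscreteTopology (F.obj X) := ⟨rfl⟩
    rw [nhds_discrete, ← Filter.principal_singleton, Filter.comap_principal]
    rfl
  obtain ⟨⟨X₀, ⟨x₀⟩⟩, h'⟩ := hF
  have : Nonempty (Σ X : C, F.obj X) := ⟨⟨X₀, x₀⟩⟩
  rw [h, Filter.mem_iInf_of_directed] at hU
  · obtain ⟨⟨X, x⟩, hx⟩ := hU
    exact ⟨X, x, fun σ hσ => hx hσ⟩
  · rintro ⟨X, x⟩ ⟨Y, y⟩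
    obtain ⟨Z, p, q, z, rfl, rfl⟩ := h' X Y x y
    refine ⟨⟨Z, z⟩, ?_, ?_⟩
    · refine Filter.principal_mono.2 fun σ (hσ : autAction F σ Z z = z) => ?_
      exact (autAction_map σ p z).trans (by rw [hσ])
    · refine Filter.principal_mono.2 fun σ (hσ : autAction F σ Z z = z) => ?_
      exact (autAction_map σ q z).trans (by rw [hσ])

variable (F) in
/-- The functor `F`, with the action of `Aut F`. -/
def fibreGSet : C ⥤ GSet.{w} (Aut F) where
  obj X :=
    letI : MulAction (Aut F) (F.obj X) :=
      { smul := fun σ x => autAction F σ X x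
        one_smul := fun _ => rfl
        mul_smul := fun _ _ _ => rfl }
    { carrier := F.obj X
      continuous := GSet.continuousSMul_bot_of_isOpen fun x y => isOpen_setOf_autAction X x y }
  map f := GSet.homMk (fun x => F.map f x) fun σ x => (autAction_map σ f x).symm
  map_id X := GSet.hom_ext fun x => F.map_id_apply X x
  map_comp f g := GSet.hom_ext fun x => F.map_comp_apply f g x

end Topology

/-! ### Fibres of coproducts and products -/

section Fibre

variable {C : Type u₁} [Category.{v₁} C] {F : C ⥤ Type w}

lemma exists_map_inj_eq [PreservesColimitsOfSize.{w, w} F] {ι : Type w} {Y : ι → C} {c : Cofan Y}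
    (hc : IsColimit c) (z : F.obj c.pt) : ∃ (i : ι) (y : F.obj (Y i)), F.map (c.inj i) y = z := by
  obtain ⟨⟨i⟩, y, h⟩ := Types.jointly_surjective_of_isColimit (isColimitOfPreserves F hc) z
  exact ⟨i, y, h⟩

lemma sigma_eq_of_map_inj_eq [PreservesColimitsOfSize.{w, w} F] {ι : Type w} {Y : ι → C}
    {c : Cofan Y} (hc : IsColimit c) {i j : ι} {y : F.obj (Y i)} {z : F.obj (Y j)}
    (h : F.map (c.inj i) y = F.map (c.inj j) z) :
    (⟨i, y⟩ : Σ i, F.obj (Y i)) = ⟨j, z⟩ := by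
  have hc' : IsColimit (Cofan.mk c.pt c.inj) :=
    IsColimit.ofIsoColimit hc (Cocone.ext (Iso.refl _) fun _ => by simp [Cofan.inj])
  have := (Cofan.nonempty_isColimit_iff_bijective_fromSigma _).1
    ⟨isColimitCofanMkObjOfIsColimit F _ _ hc'⟩
  exact this.1 h

lemma exists_prod_point [HasFiniteLimits C] [PreservesFiniteLimits F] {X Y : C} (x : F.obj X)
    (y : F.obj Y) : ∃ z : F.obj (X ⨯ Y), F.map prod.fst z = x ∧ F.map prod.snd z = y := by
  let l := isLimitOfHasBinaryProductOfPreservesLimit F X Y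
  let s := BinaryFan.IsLimit.lift' l (TypeCat.ofHom fun _ : PUnit => x)
    (TypeCat.ofHom fun _ : PUnit => y)
  exact ⟨s.1 PUnit.unit, ConcreteCategory.congr_hom s.2.1 PUnit.unit,
    ConcreteCategory.congr_hom s.2.2 PUnit.unit⟩

lemma prod_point_ext [HasFiniteLimits C] [PreservesFiniteLimits F] {X Y : C}
    {z z' : F.obj (X ⨯ Y)} (h₁ : F.map prod.fst z = F.map prod.fst z')
    (h₂ : F.map prod.snd z = F.map prod.snd z') : z = z' := by
  have : (TypeCat.ofHom fun _ : PUnit => z) = TypeCat.ofHom fun _ : PUnit => z' :=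
    BinaryFan.IsLimit.hom_ext (isLimitOfHasBinaryProductOfPreservesLimit F X Y)
      (by ext; exact h₁) (by ext; exact h₂)
  exact ConcreteCategory.congr_hom this PUnit.unit

lemma exists_terminal_point [HasFiniteLimits C] [PreservesFiniteLimits F] :
    Nonempty (F.obj (⊤_ C)) := by
  let l : IsTerminal (F.obj (⊤_ C)) := isLimitOfHasTerminalOfPreservesLimit F
  exact ⟨l.from PUnit PUnit.unit⟩

variable (F) in
lemma hasJointPoints [HasFiniteLimits C] [PreservesFiniteLimits F] : HasJointPoints F :=
  ⟨⟨_, exists_terminal_point⟩, fun X Y x y => by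
    obtain ⟨z, h₁, h₂⟩ := exists_prod_point x y
    exact ⟨X ⨯ Y, prod.fst, prod.snd, z, h₁, h₂⟩⟩

end Fibre

/-! ### Tame infinite Galois categories as categories of continuous sets -/

namespace IsTameInfiniteGalois

variable {C : Type u₁} [Category.{v₁} C] {F : C ⥤ Type w}

/-- Stable subsets of the fibre of `X` come from morphisms to `X`. -/
lemma exists_of_stable (hF : IsTameInfiniteGalois F) (X : C) (A : Set (F.obj X))
    (hA : ∀ σ : Aut F, ∀ x ∈ A, autAction F σ X x ∈ A) :
    ∃ (W : C) (i : W ⟶ X), Function.Injective (F.map i) ∧ Set.range (F.map i) = A := by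
  have := hF.hasColimits
  have := hF.preservesColimits
  obtain ⟨ι, Y, c, hY, ⟨hc⟩, ⟨e⟩⟩ := hF.exists_decomposition X
  -- Keep the components whose fibre meets `A`. Transitivity on a connected fibre will show that
  -- such a fibre lies entirely in `A`.
  let κ := {i : ι // ∃ y : F.obj (Y i), F.map (c.inj i ≫ e.hom) y ∈ A}
  let Y' : κ → C := fun k => Y k.1
  let j : ∐ Y' ⟶ X := Limits.Sigma.desc fun k => c.inj k.1 ≫ e.hom
  have hj : ∀ (k : κ) (y : F.obj (Y' k)), F.map j (F.map ((Cofan.mk _ (Sigma.ι Y')).inj k) y) =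
      F.map e.hom (F.map (c.inj k.1) y) := fun k y => by
    rw [← F.map_comp_apply, ← F.map_comp_apply]
    exact ConcreteCategory.congr_hom
      (congrArg F.map (Sigma.ι_desc (fun k : κ => c.inj k.1 ≫ e.hom) k)) y
  have he : Function.Injective (F.map e.hom) :=
    ((isIso_iff_bijective (F.map e.hom)).1 inferInstance).1
  refine ⟨∐ Y', j, fun a b hab => ?_, Set.eq_of_subset_of_subset ?_ fun x hx => ?_⟩
  · obtain ⟨k, a, rfl⟩ := exists_map_inj_eq (coproductIsCoproduct Y') a
    obtain ⟨l, b, rfl⟩ := exists_map_inj_eq (coproductIsCoproduct Y') b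
    rw [hj, hj] at hab
    obtain ⟨k, hk⟩ := k
    obtain ⟨l, hl⟩ := l
    have h := sigma_eq_of_map_inj_eq hc (he hab)
    obtain rfl : k = l := congrArg Sigma.fst h
    rw [eq_of_heq (Sigma.mk.inj h).2]
  · rintro _ ⟨a, rfl⟩
    obtain ⟨⟨k, y, hy⟩, a, rfl⟩ := exists_map_inj_eq (coproductIsCoproduct Y') a
    rw [hj]
    obtain ⟨σ, hσ⟩ := hF.transitive (Y k) (hY k) y a
    have := hA σ _ hy
    rw [autAction_map, F.map_comp_apply] at this
    change autAction F σ _ y = a at hσ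
    rwa [hσ] at this
  · obtain ⟨z, rfl⟩ := ((isIso_iff_bijective (F.map e.hom)).1 inferInstance).2 x
    obtain ⟨i, y, rfl⟩ := exists_map_inj_eq hc z
    refine ⟨F.map ((Cofan.mk _ (Sigma.ι Y')).inj ⟨i, y, ?_⟩) y, hj _ _⟩
    rwa [F.map_comp_apply]

/-- The graph of an equivariant map is stable, so it comes from some `W ⟶ X ⨯ Y`. Its projection to
`X` is bijective on fibres, hence an isomorphism, and the morphism sought is its inverse followed by
the projection to `Y`. -/
lemma full (hF : IsTameInfiniteGalois F) : (fibreGSet F).Full where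
  map_surjective {X Y} f := by
    have := hF.hasFiniteLimits
    have := hF.preservesFiniteLimits
    have := hF.reflectsIsomorphisms
    obtain ⟨W, i, hi, hA⟩ := hF.exists_of_stable (X ⨯ Y)
      {z | F.map prod.snd z = f.1 (F.map prod.fst z)} fun σ z hz => by
        change F.map _ _ = f.1 (F.map _ _)
        rw [← autAction_map, ← autAction_map, show F.map prod.snd z = _ from hz]
        exact (f.2 σ _).symm
    have hmem : ∀ a, F.map prod.snd (F.map i a) = f.1 (F.map prod.fst (F.map i a)) := fun a => by
      have : F.map i a ∈ Set.range (F.map i) := ⟨a, rfl⟩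
      rw [hA] at this
      exact this
    have hp : Function.Bijective (F.map (i ≫ prod.fst)) := by
      constructor
      · intro a b hab
        rw [F.map_comp_apply, F.map_comp_apply] at hab
        refine hi (prod_point_ext hab ?_)
        rw [hmem, hmem, hab]
      · intro x
        obtain ⟨z, h₁, h₂⟩ := exists_prod_point (F := F) x (show F.obj Y from f.1 x)
        have hz : z ∈ Set.range (F.map i) := by
          rw [hA]
          change F.map _ _ = f.1 (F.map _ _)
          rw [h₁, h₂]
        obtain ⟨a, rfl⟩ := hz
        exact ⟨a, by rw [F.map_comp_apply, h₁]⟩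
    have : IsIso (F.map (i ≫ prod.fst)) := (isIso_iff_bijective _).2 hp
    have : IsIso (i ≫ (prod.fst : X ⨯ Y ⟶ X)) := isIso_of_reflects_iso _ F
    refine ⟨inv (i ≫ (prod.fst : X ⨯ Y ⟶ X)) ≫ i ≫ prod.snd, GSet.hom_ext fun x => ?_⟩
    obtain ⟨a, rfl⟩ := hp.2 x
    change F.map _ (F.map _ a) = _
    rw [← F.map_comp_apply, IsIso.hom_inv_id_assoc, F.map_comp_apply, hmem, F.map_comp_apply]

lemma faithful_fibreGSet (hF : IsTameInfiniteGalois F) : (fibreGSet F).Faithful where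
  map_injective {X Y f g} h := by
    have := hF.faithful
    refine F.map_injective ?_
    ext x
    exact congrArg (fun k => k.1 x) h

/-- The open stabilizer of `s` contains that of a point `y` in the fibre of a connected object, so
sending `σ y` to `σ • s` is well defined, and by tameness it is defined on the whole fibre. The
coproduct of these maps over all `s` is surjective. -/
lemma exists_surjective (hF : IsTameInfiniteGalois F) (S : GSet.{w} (Aut F)) :
    ∃ (Z : C) (p : (fibreGSet F).obj Z ⟶ S), Function.Surjective p.1 := by
  have := hF.hasColimits
  have := hF.preservesColimits
  have := hF.hasFiniteLimits
  have := hF.preservesFiniteLimits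
  have key : ∀ s : S.carrier, ∃ (Y : C) (y : F.obj Y) (p : (fibreGSet F).obj Y ⟶ S),
      p.1 y = s := fun s => by
    obtain ⟨X, x, hx⟩ := (hasJointPoints F).exists_stabilizer_subset
      ((GSet.isOpen_setOf_smul_eq S s s).mem_nhds (one_smul _ s))
    -- Pass from `X` to the connected component through `x`, where the action is transitive.
    obtain ⟨ι, Y, c, hY, ⟨hc⟩, ⟨e⟩⟩ := hF.exists_decomposition X
    obtain ⟨z, rfl⟩ := ((isIso_iff_bijective (F.map e.hom)).1 inferInstance).2 x
    obtain ⟨i, y, rfl⟩ := exists_map_inj_eq hc z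
    have hs : ∀ σ τ : Aut F, autAction F σ _ y = autAction F τ _ y → σ • s = τ • s :=
      fun σ τ h => by
        have : (τ⁻¹ * σ) • s = s := hx (τ⁻¹ * σ) (by
          rw [autAction_map, autAction_map, autAction_mul, h, ← autAction_mul, inv_mul_cancel,
            autAction_one])
        rw [mul_smul, inv_smul_eq_iff] at this
        exact this
    choose t ht using hF.transitive (Y i) (hY i) y
    refine ⟨Y i, y, GSet.homMk (fun z => t z • s) fun σ z => ?_, ?_⟩
    · rw [← mul_smul]
      refine hs _ _ ((ht _).trans ?_)
      rw [autAction_mul]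
      exact congrArg (autAction F σ (Y i)) (ht z).symm
    · exact (hs _ 1 ((ht y).trans rfl)).trans (one_smul _ s)
  choose Y y p hp using key
  have hsig : Function.Bijective (fun a : Σ s, F.obj (Y s) =>
      F.map ((Cofan.mk _ (Sigma.ι Y)).inj a.1) a.2) :=
    ⟨fun a b h => sigma_eq_of_map_inj_eq (coproductIsCoproduct Y) h, fun z => by
      obtain ⟨i, y, h⟩ := exists_map_inj_eq (coproductIsCoproduct Y) z
      exact ⟨⟨i, y⟩, h⟩⟩
  let e := Equiv.ofBijective _ hsig
  have he : ∀ s (a : F.obj (Y s)), e.symm (F.map (Sigma.ι Y s) a) = ⟨s, a⟩ := fun s a =>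
    e.symm_apply_apply ⟨s, a⟩
  let Q : (Σ s, F.obj (Y s)) → S.carrier := fun a => (p a.1).1 a.2
  refine ⟨∐ Y, GSet.homMk (fun z => Q (e.symm z)) fun σ z => ?_, fun s =>
    ⟨F.map (Sigma.ι Y s) (y s), ?_⟩⟩
  · obtain ⟨⟨s, a⟩, rfl⟩ := e.surjective z
    change Q (e.symm (autAction F σ _ (F.map (Sigma.ι Y s) a))) = σ • Q (e.symm (e ⟨s, a⟩))
    rw [autAction_map, he, Equiv.symm_apply_apply]
    exact (p s).2 σ a
  · change (p (e.symm (F.map (Sigma.ι Y s) (y s))).1).1 _ = s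
    rw [he]
    exact hp s

/-- Given a surjection from the fibre of `Z`, its kernel relation is a stable subset of the fibre of
`Z ⨯ Z` and comes from some `W`. The coequalizer of the two maps `W ⟶ Z` is preserved by `F`, so its
fibre is the quotient set. -/
lemma essSurj (hF : IsTameInfiniteGalois F) : (fibreGSet F).EssSurj where
  mem_essImage S := by
    have := hF.hasColimits
    have := hF.preservesColimits
    have := hF.hasFiniteLimits
    have := hF.preservesFiniteLimits
    obtain ⟨Z, p, hp⟩ := hF.exists_surjective S
    obtain ⟨W, i, hi, hA⟩ := hF.exists_of_stable (Z ⨯ Z)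
      {z | p.1 (F.map prod.fst z) = p.1 (F.map prod.snd z)} fun σ z hz => by
        change p.1 (F.map _ _) = p.1 (F.map _ _)
        rw [← autAction_map, ← autAction_map]
        exact (p.2 σ _).trans ((congrArg (σ • ·) hz).trans (p.2 σ _).symm)
    let a : W ⟶ Z := i ≫ prod.fst
    let b : W ⟶ Z := i ≫ prod.snd
    have hab : F.map a ≫ TypeCat.ofHom p.1 = F.map b ≫ TypeCat.ofHom p.1 := by
      ext x
      have : F.map i x ∈ Set.range (F.map i) := ⟨x, rfl⟩
      rw [hA] at this
      change p.1 (F.map (i ≫ _) x) = p.1 (F.map (i ≫ _) x)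
      rw [F.map_comp_apply, F.map_comp_apply]
      exact this
    let l := isColimitOfHasCoequalizerOfPreservesColimit F a b
    let d := Cofork.IsColimit.desc' l (TypeCat.ofHom p.1) hab
    have hd : ∀ z : F.obj Z, d.1 (F.map (coequalizer.π a b) z) = p.1 z := fun z =>
      ConcreteCategory.congr_hom d.2 z
    have hπ : Function.Surjective (F.map (coequalizer.π a b)) :=
      (epi_iff_surjective _).1 inferInstance
    let f : (fibreGSet F).obj (coequalizer a b) ⟶ S := GSet.homMk (fun x => d.1 x) fun σ x => by
      obtain ⟨z, rfl⟩ := hπ x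
      change d.1 (autAction F σ _ _) = _
      rw [autAction_map, hd, hd]
      exact p.2 σ z
    have : IsIso f := GSet.isIso_of_bijective f ⟨fun x y hxy => by
      obtain ⟨x, rfl⟩ := hπ x
      obtain ⟨y, rfl⟩ := hπ y
      replace hxy : p.1 x = p.1 y := (hd x).symm.trans (hxy.trans (hd y))
      obtain ⟨z, rfl, rfl⟩ := exists_prod_point (F := F) x y
      have hz : z ∈ Set.range (F.map i) := by rw [hA]; exact hxy
      obtain ⟨t, rfl⟩ := hz
      have := ConcreteCategory.congr_hom (congrArg F.map (coequalizer.condition a b)) t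
      simp only [a, b, Functor.map_comp_apply] at this
      exact this, fun s => by
      obtain ⟨z, rfl⟩ := hp s
      exact ⟨F.map (coequalizer.π a b) z, hd z⟩⟩
    exact ⟨_, ⟨asIso f⟩⟩

/-- A tame infinite Galois category is equivalent to the category of sets with a continuous action
of its fundamental group. -/
theorem isEquivalence_fibreGSet (hF : IsTameInfiniteGalois F) : (fibreGSet F).IsEquivalence where
  faithful := hF.faithful_fibreGSet
  full := hF.full
  essSurj := hF.essSurj

end IsTameInfiniteGalois

/-! ### Smallness of the fundamental group -/

section Small

variable {C : Type u₁} [Category.{v₁} C] {F : C ⥤ Type w}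

/-- An automorphism of `F` is determined by its values on the generators, since agreement of two
automorphisms passes to colimits that `F` preserves. -/
lemma IsInfiniteGalois.small_aut (hF : IsInfiniteGalois F) : Small.{w} (Aut F) := by
  have := hF.preservesColimits
  obtain ⟨ι, S, -, hS⟩ := hF.exists_generators
  refine small_of_injective (β := ∀ i, F.obj (S i) → F.obj (S i))
    (f := fun σ i x => autAction F σ (S i) x) fun σ τ h => aut_ext fun X => ?_
  have hX : (ObjectProperty.ofObj S).colimitsClosure
      (fun K : Cat.{w, w} => (K : Type w)) X := hS ▸ trivial
  induction hX with
  | of_mem X hX =>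
    obtain ⟨i⟩ := hX
    exact fun x => congrFun (congrFun h i) x
  | of_isoClosure e _ ih =>
    intro x
    obtain ⟨z, rfl⟩ := ((isIso_iff_bijective (F.map e.hom)).1 inferInstance).2 x
    rw [autAction_map, autAction_map, ih]
  | of_colimitPresentation pres _ ih =>
    intro x
    obtain ⟨j, y, rfl⟩ :=
      Types.jointly_surjective_of_isColimit (isColimitOfPreserves F pres.isColimit) x
    have := ih j y
    change autAction F σ _ (F.map _ _) = autAction F τ _ (F.map _ _)
    rw [autAction_map, autAction_map]
    exact congrArg _ this

end Small

/-! ### The Noohi coproduct: density of the free product, and smallness -/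

section Coprod

variable {G : Type u₁} [Group G] [TopologicalSpace G] {H : Type u₂} [Group H] [TopologicalSpace H]

namespace BiSet

/-- The set with two actions given by two homomorphisms to a permutation group for which the
transporters are open. -/
def ofHom {S : Type w} (ρ : G →* Equiv.Perm S) (hρ : ∀ x y, IsOpen {g | ρ g x = y})
    (θ : H →* Equiv.Perm S) (hθ : ∀ x y, IsOpen {h | θ h x = y}) : BiSet.{w} G H :=
  letI : MulAction G S := MulAction.compHom S ρ
  letI : MulAction H S := MulAction.compHom S θ
  { carrier := S
    continuousLeft := GSet.continuousSMul_bot_of_isOpen hρ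
    continuousRight := GSet.continuousSMul_bot_of_isOpen hθ }

lemma isOpen_left (X : BiSet.{w} G H) (x y : X.carrier) : IsOpen {g : G | g • x = y} :=
  GSet.isOpen_setOf_smul_eq ⟨X.carrier, X.continuousLeft⟩ x y

lemma isOpen_right (X : BiSet.{w} G H) (x y : X.carrier) : IsOpen {h : H | h • x = y} :=
  GSet.isOpen_setOf_smul_eq ⟨X.carrier, X.continuousRight⟩ x y

/-- The product of two sets with two actions. -/
def prod (X Y : BiSet.{w} G H) : BiSet.{w} G H where
  carrier := X.carrier × Y.carrier
  continuousLeft := GSet.continuousSMul_bot_of_isOpen fun x y => by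
    have : {g : G | g • x = y} = {g | g • x.1 = y.1} ∩ {g | g • x.2 = y.2} := by
      ext g
      exact Prod.ext_iff
    rw [this]
    exact (X.isOpen_left _ _).inter (Y.isOpen_left _ _)
  continuousRight := GSet.continuousSMul_bot_of_isOpen fun x y => by
    have : {h : H | h • x = y} = {h | h • x.1 = y.1} ∩ {h | h • x.2 = y.2} := by
      ext g
      exact Prod.ext_iff
    rw [this]
    exact (X.isOpen_right _ _).inter (Y.isOpen_right _ _)

/-- The set with two actions on a subset that is stable under both actions. -/
def ofSubset (X : BiSet.{w} G H) (A : Set X.carrier) (hG : ∀ (g : G), ∀ x ∈ A, g • x ∈ A)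
    (hH : ∀ (h : H), ∀ x ∈ A, h • x ∈ A) : BiSet.{w} G H :=
  letI : MulAction G A := (GSet.ofSubset ⟨X.carrier, X.continuousLeft⟩ A hG).action
  letI : MulAction H A := (GSet.ofSubset ⟨X.carrier, X.continuousRight⟩ A hH).action
  { carrier := A
    continuousLeft := (GSet.ofSubset ⟨X.carrier, X.continuousLeft⟩ A hG).continuous
    continuousRight := (GSet.ofSubset ⟨X.carrier, X.continuousRight⟩ A hH).continuous }

variable (G H) in
lemma hasJointPoints_forget : HasJointPoints (forget.{w} G H) := by
  refine ⟨⟨ofHom (S := PUnit) 1 (fun _ _ => ?_) 1 (fun _ _ => ?_), ⟨PUnit.unit⟩⟩,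
    fun X Y x y => ⟨prod X Y, ⟨Prod.fst, fun _ _ => rfl, fun _ _ => rfl⟩,
      ⟨Prod.snd, fun _ _ => rfl, fun _ _ => rfl⟩, (x, y), rfl, rfl⟩⟩ <;>
  simp

end BiSet

namespace NoohiCoprod

/-- The action of `NoohiCoprod G H` on a set with two actions. -/
def act (σ : NoohiCoprod.{w} G H) {X : BiSet.{w} G H} (x : X.carrier) : X.carrier :=
  autAction (BiSet.forget G H) σ X x

lemma act_one {X : BiSet.{w} G H} (x : X.carrier) : act (1 : NoohiCoprod.{w} G H) x = x := rfl

lemma act_mul (σ τ : NoohiCoprod.{w} G H) {X : BiSet.{w} G H} (x : X.carrier) :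
    act (σ * τ) x = act σ (act τ x) := rfl

lemma act_inl (g : G) {X : BiSet.{w} G H} (x : X.carrier) :
    act (inl g : NoohiCoprod.{w} G H) x = g • x := rfl

lemma act_inr (h : H) {X : BiSet.{w} G H} (x : X.carrier) :
    act (inr h : NoohiCoprod.{w} G H) x = h • x := rfl

lemma act_inv_eq_iff (σ : NoohiCoprod.{w} G H) {X : BiSet.{w} G H} (x y : X.carrier) :
    act σ⁻¹ x = y ↔ act σ y = x :=
  autAction_inv_eq_iff σ X x y

lemma act_map (σ : NoohiCoprod.{w} G H) {X Y : BiSet.{w} G H} (f : X ⟶ Y) (x : X.carrier) :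
    act σ (f.1 x) = f.1 (act σ x) :=
  autAction_map σ f x

lemma ext_act {σ τ : NoohiCoprod.{w} G H}
    (h : ∀ (X : BiSet.{w} G H) (x : X.carrier), act σ x = act τ x) : σ = τ :=
  aut_ext h

variable (G H) in
/-- The homomorphism from the free product of the abstract groups. -/
def ofCoprod : Monoid.Coprod G H →* NoohiCoprod.{w} G H :=
  Monoid.Coprod.lift (inl : G →ₜ* NoohiCoprod.{w} G H).toMonoidHom
    (inr : H →ₜ* NoohiCoprod.{w} G H).toMonoidHom

lemma ofCoprod_inl (g : G) : ofCoprod.{w} G H (Monoid.Coprod.inl g) = inl g :=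
  Monoid.Coprod.lift_apply_inl _ _ _

lemma ofCoprod_inr (h : H) : ofCoprod.{w} G H (Monoid.Coprod.inr h) = inr h :=
  Monoid.Coprod.lift_apply_inr _ _ _

/-- The set with two actions generated by a point. -/
def orbitObj (X : BiSet.{w} G H) (x : X.carrier) : BiSet.{w} G H :=
  X.ofSubset (Set.range fun k => act (ofCoprod G H k) x)
    (by
      rintro g _ ⟨k, rfl⟩
      exact ⟨Monoid.Coprod.inl g * k, by simp only [map_mul, ofCoprod_inl, act_mul, act_inl]⟩)
    (by
      rintro h _ ⟨k, rfl⟩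
      exact ⟨Monoid.Coprod.inr h * k, by simp only [map_mul, ofCoprod_inr, act_mul, act_inr]⟩)

/-- The inclusion of the set with two actions generated by a point. -/
def orbitIncl (X : BiSet.{w} G H) (x : X.carrier) : orbitObj X x ⟶ X :=
  ⟨Subtype.val, fun _ _ => rfl, fun _ _ => rfl⟩

/-- The generating point. -/
def orbitPoint (X : BiSet.{w} G H) (x : X.carrier) : (orbitObj X x).carrier :=
  ⟨x, 1, by simp only [map_one, act_one]⟩

/-- The orbit of `x` under the free product is itself a set with two actions, so naturality along
its inclusion keeps `σ` inside that orbit. -/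
lemma exists_act_eq (σ : NoohiCoprod.{w} G H) {X : BiSet.{w} G H} (x : X.carrier) :
    ∃ k, act σ x = act (ofCoprod G H k) x := by
  obtain ⟨k, hk⟩ := (act σ (orbitPoint X x)).2
  exact ⟨k, (act_map σ (orbitIncl X x) (orbitPoint X x)).trans hk.symm⟩

/-- The free product has dense image. -/
lemma exists_inv_mul_mem {U : Set (NoohiCoprod.{w} G H)} (hU : U ∈ nhds 1)
    (σ : NoohiCoprod.{w} G H) : ∃ k, (ofCoprod G H k)⁻¹ * σ ∈ U := by
  obtain ⟨X, x, hx⟩ := (BiSet.hasJointPoints_forget G H).exists_stabilizer_subset hU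
  obtain ⟨k, hk⟩ := exists_act_eq σ x
  exact ⟨k, hx _ ((act_inv_eq_iff (ofCoprod G H k) (act σ x) x).2 hk.symm)⟩

/-- Maps between `NoohiCoprod G H`-sets are equivariant if they are so for `G` and `H`. -/
lemma map_smul_of_inl_inr {X Y : GSet.{w} (NoohiCoprod.{w} G H)} (f : X.carrier → Y.carrier)
    (hG : ∀ (g : G) x, f ((inl g : NoohiCoprod.{w} G H) • x) = (inl g : NoohiCoprod.{w} G H) • f x)
    (hH : ∀ (h : H) x, f ((inr h : NoohiCoprod.{w} G H) • x) = (inr h : NoohiCoprod.{w} G H) • f x)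
    (σ : NoohiCoprod.{w} G H) (x : X.carrier) : f (σ • x) = σ • f x := by
  -- Intersecting both stabilizers yields one word `k` that agrees with `σ` at `x` and at `f x`
  -- simultaneously.
  have hU : {τ : NoohiCoprod.{w} G H | τ • x = x} ∩ {τ | τ • f x = f x} ∈ nhds 1 :=
    ((GSet.isOpen_setOf_smul_eq X x x).inter (GSet.isOpen_setOf_smul_eq Y _ _)).mem_nhds
      ⟨one_smul _ _, one_smul _ _⟩
  obtain ⟨k, h₁, h₂⟩ := exists_inv_mul_mem hU σ
  have h₁' : σ • x = ofCoprod G H k • x := by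
    rw [← inv_smul_eq_iff, ← mul_smul]; exact h₁
  have h₂' : σ • f x = ofCoprod G H k • f x := by
    rw [← inv_smul_eq_iff, ← mul_smul]; exact h₂
  rw [h₁', h₂']
  clear h₁ h₂ h₁' h₂' hU
  induction k using Monoid.Coprod.induction_on generalizing x with
  | inl g => rw [ofCoprod_inl]; exact hG g x
  | inr h => rw [ofCoprod_inr]; exact hH h x
  | mul k l hk hl => rw [map_mul, mul_smul, mul_smul, hk, hl]

/-- The set with two actions generated by `x` maps to every set with two actions that has a point
`y` whose stabilizer contains that of `x`. -/
lemma exists_hom_of_stabilizer_le {X Y : BiSet.{w} G H} (x : X.carrier) (y : Y.carrier)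
    (h : ∀ k, act (ofCoprod G H k) x = x → act (ofCoprod G H k) y = y) :
    ∃ f : orbitObj X x ⟶ Y, f.1 (orbitPoint X x) = y := by
  have h' : ∀ k l, act (ofCoprod G H k) x = act (ofCoprod G H l) x →
      act (ofCoprod G H k) y = act (ofCoprod G H l) y := fun k l hkl => by
    have := h (l⁻¹ * k) (by rw [map_mul, map_inv, act_mul, act_inv_eq_iff, hkl])
    rwa [map_mul, map_inv, act_mul, act_inv_eq_iff, eq_comm] at this
  choose t ht using fun z : Set.range (fun k => act (ofCoprod G H k) x) => z.2
  replace ht : ∀ z, act (ofCoprod G H (t z)) x = z.1 := ht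
  have key : ∀ k z z', act (ofCoprod G H k) z.1 = z'.1 → act (ofCoprod G H (t z')) y =
      act (ofCoprod G H k) (act (ofCoprod G H (t z)) y) := fun k z z' hz => by
    rw [← act_mul, ← map_mul]
    refine h' _ _ ((ht z').trans ?_)
    rw [map_mul, act_mul, ← hz, ht]
  refine ⟨⟨fun z => act (ofCoprod G H (t z)) y, fun g z => ?_, fun g z => ?_⟩, ?_⟩
  · have := key (Monoid.Coprod.inl g) z (g • z) (by rw [ofCoprod_inl]; rfl)
    rwa [ofCoprod_inl] at this
  · have := key (Monoid.Coprod.inr g) z (g • z) (by rw [ofCoprod_inr]; rfl)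
    rwa [ofCoprod_inr] at this
  · exact (h' _ 1 ((ht (orbitPoint X x)).trans (by rw [map_one]; rfl))).trans
      (by rw [map_one, act_one])

/-- The value of `σ` at `x` is given by a word `k`, and whether `k` works depends only on the
stabilizer of `x` in the free product, because points with the same stabilizer generate isomorphic
orbits. So `σ` is encoded by a function on subsets of the free product. -/
instance small [Small.{w} G] [Small.{w} H] : Small.{w} (NoohiCoprod.{w} G H) := by
  have : Small.{w} (FreeMonoid (G ⊕ H)) := inferInstanceAs (Small.{w} (List (G ⊕ H)))
  have : Small.{w} (Monoid.Coprod G H) := small_of_surjective Monoid.Coprod.mk_surjective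
  refine small_of_injective (β := Set (Monoid.Coprod G H) → Set (Monoid.Coprod G H))
    (f := fun σ U => {k | ∃ (X : BiSet.{w} G H) (x : X.carrier),
      {l | act (ofCoprod G H l) x = x} = U ∧ act σ x = act (ofCoprod G H k) x})
    fun σ τ h => ext_act fun X x => ?_
  obtain ⟨k, hk⟩ := exists_act_eq σ x
  have hmem := (Set.ext_iff.1 (congrFun h {l | act (ofCoprod G H l) x = x}) k).1 ⟨X, x, rfl, hk⟩
  obtain ⟨Y, y, hU, hk'⟩ := hmem
  obtain ⟨f, hf⟩ := exists_hom_of_stabilizer_le y x fun l hl => (Set.ext_iff.1 hU l).1 hl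
  rw [hk, ← hf, act_map, act_map]
  refine congrArg f.1 (Subtype.ext ?_)
  refine (act_map (ofCoprod G H k) (orbitIncl Y y) (orbitPoint Y y)).symm.trans ?_
  exact hk'.symm.trans (act_map τ (orbitIncl Y y) (orbitPoint Y y))

end NoohiCoprod

end Coprod

/-! ### Equivalences induce isomorphisms of fundamental groups -/

section Transfer

variable {C : Type u₁} [Category.{v₁} C] {E : Type u₂} [Category.{v₂} E]
  {F : C ⥤ Type w} {H : E ⥤ Type w}

lemma autAction_pi1Map (t : C ⥤ E) (α : t ⋙ H ≅ F) (σ : Aut H) (X : C) (x : F.obj X) :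
    autAction F (pi1Map t α σ) X x = α.hom.app X (autAction H σ (t.obj X) (α.inv.app X x)) := rfl

lemma pi1Map_injective (t : C ⥤ E) [t.EssSurj] (α : t ⋙ H ≅ F) :
    Function.Injective (pi1Map t α) := fun σ τ h => aut_ext fun Y y => by
  let i := t.objObjPreimageIso Y
  obtain ⟨z, rfl⟩ := ((isIso_iff_bijective (H.map i.hom)).1 inferInstance).2 y
  obtain ⟨x, rfl⟩ := ((isIso_iff_bijective (α.inv.app (t.objPreimage Y))).1 inferInstance).2 z
  have := congrArg (fun ρ => autAction F ρ _ x) h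
  simp only [autAction_pi1Map] at this
  rw [autAction_map, autAction_map]
  exact congrArg _ (((isIso_iff_bijective (α.hom.app (t.objPreimage Y))).1 inferInstance).1 this)

/-- An equivalence of categories that is compatible with the functors to sets induces an
isomorphism of fundamental groups. -/
def autContinuousMulEquiv (e : C ⥤ E) [e.IsEquivalence] (i : e ⋙ H ≅ F) : Aut F ≃ₜ* Aut H :=
  let i' : e.inv ⋙ F ≅ H := Functor.isoWhiskerLeft e.inv i.symm ≪≫
    (Functor.associator _ _ _).symm ≪≫ Functor.isoWhiskerRight e.asEquivalence.counitIso H ≪≫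
    H.leftUnitor
  have h : ∀ σ, pi1Map e.inv i' (pi1Map e i σ) = σ := fun σ => aut_ext fun Y y => by
    let ε : e.obj (e.inv.obj Y) ≅ Y := e.asEquivalence.counitIso.app Y
    have h₁ : ∀ x, i'.hom.app Y x = H.map ε.hom (i.inv.app (e.inv.obj Y) x) := fun x => by
      simp [i']
      rfl
    have h₂ : i'.inv.app Y y = i.hom.app (e.inv.obj Y) (H.map ε.inv y) := by
      simp [i']
      rfl
    have h₃ : ∀ x : H.obj (e.obj (e.inv.obj Y)), i.inv.app _ (i.hom.app (e.inv.obj Y) x) = x :=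
      fun x => Iso.hom_inv_id_app_apply i (e.inv.obj Y) x
    rw [autAction_pi1Map, autAction_pi1Map, h₁, h₂]
    refine (congrArg (H.map ε.hom) ((h₃ _).trans (congrArg (autAction H σ _) (h₃ _)))).trans ?_
    rw [← autAction_map, ← H.map_comp_apply, Iso.inv_hom_id, H.map_id_apply]
  { toFun := pi1Map e.inv i'
    invFun := pi1Map e i
    -- A one-sided inverse of an injective map is two-sided.
    left_inv := fun τ => pi1Map_injective e.inv i' (h _)
    right_inv := h
    map_mul' := map_mul _
    continuous_toFun := (pi1Map e.inv i').continuous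
    continuous_invFun := (pi1Map e i).continuous }

end Transfer

/-! ### Restriction to a group and descent to a quotient -/

namespace GSet

variable {T : Type u₁} [Group T] [TopologicalSpace T] {T' : Type u₂} [Group T']
  [TopologicalSpace T']

/-- Restriction of the action along a continuous homomorphism. -/
def restrict (f : T' →ₜ* T) (X : GSet.{w} T) : GSet.{w} T' :=
  ofHom ((MulAction.toPermHom T X.carrier).comp f.toMonoidHom) fun x y =>
    (isOpen_setOf_smul_eq X x y).preimage f.continuous

/-- The action of a quotient group. -/
def quotient (N : Subgroup T) [N.Normal] (X : GSet.{w} T)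
    (hN : ∀ n ∈ N, ∀ x : X.carrier, n • x = x) : GSet.{w} (T ⧸ N) :=
  ofHom (QuotientGroup.lift N (MulAction.toPermHom T X.carrier) fun n hn =>
    Equiv.ext (hN n hn)) fun x y => isOpen_setOf_smul_eq X x y

end GSet

/-! ### The group of paths -/

namespace PathGroup

variable {s : ℕ}

lemma u_mul_u (i j k : Fin s) : (u i j : PathGroup s) * u j k = u i k := by
  have h := PresentedGroup.mk_eq_one_iff (rels :=
      ({r | ∃ i : Fin s, r = FreeGroup.of (i, i)} ∪
      {r | ∃ i j k : Fin s,
        r = FreeGroup.of (i, j) * FreeGroup.of (j, k) * (FreeGroup.of (i, k))⁻¹} :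
      Set (FreeGroup (Fin s × Fin s)))) |>.2
      (Subgroup.subset_normalClosure (Or.inr ⟨i, j, k, rfl⟩))
  rw [map_mul, map_mul, map_inv, mul_inv_eq_one] at h
  exact h

lemma u_self (i : Fin s) : (u i i : PathGroup s) = 1 := by
  have := u_mul_u i i i
  exact mul_eq_left.1 this

lemma inv_v_mul_v [NeZero s] (i j : Fin s) : (v i : PathGroup s)⁻¹ * v j = u i j := by
  rw [inv_mul_eq_iff_eq_mul]
  exact (u_mul_u 0 i j).symm

/-- The action of `PathGroup s` on a set `S` given by bijections from `S` to another set. -/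
def permHom {S S' : Type*} (e : Fin s → S ≃ S') : PathGroup s →* Equiv.Perm S :=
  PresentedGroup.toGroup (f := fun p : Fin s × Fin s => (e p.2).trans (e p.1).symm) (by
    rintro _ (⟨i, rfl⟩ | ⟨i, j, k, rfl⟩) <;> ext x <;> simp)

lemma permHom_u {S S' : Type*} (e : Fin s → S ≃ S') (i j : Fin s) (x : S) :
    permHom e (u i j) x = (e i).symm (e j x) := by
  have : permHom e (u i j) = (e j).trans (e i).symm := PresentedGroup.toGroup.of _
  rw [this]
  rfl

lemma induction_on {p : PathGroup s → Prop} (x : PathGroup s) (hu : ∀ i j, p (u i j))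
    (hinv : ∀ x, p x → p x⁻¹) (one : p 1) (hmul : ∀ x y, p x → p y → p (x * y)) : p x := by
  obtain ⟨x, rfl⟩ := PresentedGroup.mk_surjective _ x
  induction x using FreeGroup.induction_on with
  | C1 => rw [map_one]; exact one
  | of x => exact hu x.1 x.2
  | inv_of x h => rw [map_inv]; exact hinv _ h
  | mul x y hx hy => rw [map_mul]; exact hmul _ _ hx hy

end PathGroup

/-! ### Glueing a `P`-set and a `P'`-set along bijections -/

section Glue

variable {P : Type u₁} [Group P] [TopologicalSpace P] {P' : Type u₂} [Group P'] [TopologicalSpace P']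
  {s : ℕ} [NeZero s] {Q : Fin s → Type u} [∀ i, Group (Q i)] [∀ i, TopologicalSpace (Q i)]
  (ψ : ∀ i, Q i →ₜ* P) (φ : ∀ i, Q i →ₜ* P')

/-- The quotient group whose Noohi completion is `VK`. -/
abbrev VKGroup : Type (max u₁ u₂ (w + 1)) :=
  NoohiCoprod.{w} P (NoohiCoprod.{w} P' (PathGroup s)) ⧸
    Subgroup.normalClosure (vkRelators.{w} ψ φ)

namespace VKGroup

/-- The projection to `VKGroup`. -/
def mk : NoohiCoprod.{w} P (NoohiCoprod.{w} P' (PathGroup s)) →ₜ* VKGroup.{w} ψ φ :=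
  { QuotientGroup.mk' (Subgroup.normalClosure (vkRelators.{w} ψ φ)) with
    continuous_toFun := continuous_quotient_mk' }

/-- The map from the first group. -/
def ofLeft : P →ₜ* VKGroup.{w} ψ φ := (mk ψ φ).comp NoohiCoprod.inl

/-- The map from the second group. -/
def ofRight : P' →ₜ* VKGroup.{w} ψ φ :=
  (mk ψ φ).comp (NoohiCoprod.inr.comp NoohiCoprod.inl)

/-- The map from the group of paths. -/
def ofPath : PathGroup s →ₜ* VKGroup.{w} ψ φ :=
  (mk ψ φ).comp (NoohiCoprod.inr.comp NoohiCoprod.inr)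

/-- The van Kampen relation in intertwining form: the path `v i` carries the action of `Q i` through
`ψ i` to the one through `φ i`. -/
lemma ofPath_mul_ofLeft (i : Fin s) (a : Q i) :
    ofPath.{w} ψ φ (PathGroup.v i) * ofLeft ψ φ (ψ i a) =
      ofRight ψ φ (φ i a) * ofPath ψ φ (PathGroup.v i) := by
  have h : mk.{w} ψ φ ((NoohiCoprod.inl (ψ i a))⁻¹ *
      NoohiCoprod.inr ((NoohiCoprod.inr (PathGroup.v i))⁻¹ * NoohiCoprod.inl (φ i a) *
        NoohiCoprod.inr (PathGroup.v i))) = 1 :=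
    (QuotientGroup.eq_one_iff _).2 (Subgroup.subset_normalClosure ⟨i, a, rfl⟩)
  rw [map_mul, map_inv, inv_mul_eq_one] at h
  refine eq_inv_mul_iff_mul_eq.1 (h.trans ?_)
  simp only [map_mul, map_inv, mul_assoc]
  rfl

/-- Maps are equivariant if they are so for the three groups. -/
lemma map_smul {X Y : GSet.{w} (VKGroup.{w} ψ φ)} (f : X.carrier → Y.carrier)
    (h₁ : ∀ g x, f (ofLeft ψ φ g • x) = ofLeft ψ φ g • f x)
    (h₂ : ∀ g x, f (ofRight ψ φ g • x) = ofRight ψ φ g • f x)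
    (h₃ : ∀ i j x, f (ofPath ψ φ (PathGroup.u i j) • x) = ofPath ψ φ (PathGroup.u i j) • f x)
    (σ : VKGroup.{w} ψ φ) (x : X.carrier) : f (σ • x) = σ • f x := by
  obtain ⟨σ, rfl⟩ := QuotientGroup.mk_surjective σ
  -- The coproduct is nested, so the density argument is applied to the outer one and then to the
  -- inner one.
  refine NoohiCoprod.map_smul_of_inl_inr (X := X.restrict (mk ψ φ)) (Y := Y.restrict (mk ψ φ))
    f h₁ ?_ σ x
  refine NoohiCoprod.map_smul_of_inl_inr (X := X.restrict ((mk ψ φ).comp NoohiCoprod.inr))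
    (Y := Y.restrict ((mk ψ φ).comp NoohiCoprod.inr)) f h₂ fun p x => ?_
  change f (ofPath ψ φ p • (show X.carrier from x)) = ofPath ψ φ p • f x
  induction p using PathGroup.induction_on generalizing x with
  | hu i j => exact h₃ i j x
  | hinv p hp =>
    rw [map_inv, eq_inv_smul_iff]
    exact (hp _).symm.trans (congrArg f (smul_inv_smul _ _))
  | one => rw [map_one, one_smul, one_smul]
  | hmul p q hp hq =>
    rw [map_mul, mul_smul, mul_smul]
    exact (hp _).trans (congrArg _ (hq _))

instance [Small.{w} P] [Small.{w} P'] : Small.{w} (VKGroup.{w} ψ φ) :=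
  small_of_surjective QuotientGroup.mk_surjective

variable {ψ φ}
variable (X : GSet.{w} P) (Y : GSet.{w} P') (e : Fin s → X.carrier ≃ Y.carrier)

/-- Transport of the action of `P'` and the action of paths, for a `P`-set and a `P'`-set with
bijections between them. -/
def glueRight : BiSet.{w} P' (PathGroup s) :=
  BiSet.ofHom (S := X.carrier)
    ((e 0).symm.permCongrHom.toMonoidHom.comp (MulAction.toPermHom P' Y.carrier))
    (fun x y => by
      convert GSet.isOpen_setOf_smul_eq Y (e 0 x) (e 0 y) using 1
      ext g
      exact (e 0).symm_apply_eq)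
    (PathGroup.permHom e) (fun _ _ => isOpen_discrete _)

/-- The set with actions of `P` and of the Noohi coproduct of `P'` and the group of paths. -/
def glueBi : BiSet.{w} P (NoohiCoprod.{w} P' (PathGroup s)) :=
  let Z := (fibreGSet (BiSet.forget P' (PathGroup s))).obj (glueRight X Y e)
  BiSet.ofHom (S := X.carrier) (MulAction.toPermHom P X.carrier)
    (fun x y => GSet.isOpen_setOf_smul_eq X x y)
    (MulAction.toPermHom _ Z.carrier) (fun x y => GSet.isOpen_setOf_smul_eq Z x y)

/-- The kernel of an action is normal, so only the relators matter. The conjugate of `φ i a` by `v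
i` acts as `φ i a` transported along `e i`, because the two occurrences of `e 0` cancel; by `he`
this is the action of `ψ i a`. -/
lemma normalClosure_smul (he : ∀ j (a : Q j) x, e j (ψ j a • x) = φ j a • e j x) :
    ∀ n ∈ Subgroup.normalClosure (vkRelators.{w} ψ φ),
    ∀ x : ((fibreGSet (BiSet.forget P (NoohiCoprod.{w} P' (PathGroup s)))).obj
      (glueBi X Y e)).carrier, n • x = x := by
  intro n hn
  have : Subgroup.normalClosure (vkRelators.{w} ψ φ) ≤ (MulAction.toPermHom _
      ((fibreGSet (BiSet.forget P (NoohiCoprod.{w} P' (PathGroup s)))).obj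
        (glueBi X Y e)).carrier).ker := by
    refine Subgroup.normalClosure_le_normal ?_
    rintro _ ⟨i, a, rfl⟩
    refine MonoidHom.mem_ker.2 (Equiv.ext fun x => ?_)
    rw [map_mul, map_inv, Equiv.Perm.mul_apply, Equiv.Perm.inv_eq_iff_eq]
    have key : ∀ x : X.carrier, PathGroup.permHom e (PathGroup.v i)⁻¹ ((e 0).symm (φ i a • e 0
        (PathGroup.permHom e (PathGroup.v i) x))) = ψ i a • x := fun x => by
      rw [map_inv, Equiv.Perm.inv_eq_iff_eq, PathGroup.v, PathGroup.permHom_u,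
        PathGroup.permHom_u, Equiv.apply_symm_apply, he]
    exact key x
  exact fun x => Equiv.congr_fun (MonoidHom.mem_ker.1 (this hn)) x

/-- The `VKGroup`-set obtained by glueing a `P`-set and a `P'`-set along bijections. -/
def glue (he : ∀ j (a : Q j) x, e j (ψ j a • x) = φ j a • e j x) : GSet.{w} (VKGroup.{w} ψ φ) :=
  GSet.quotient _ ((fibreGSet (BiSet.forget P (NoohiCoprod.{w} P' (PathGroup s)))).obj
    (glueBi X Y e)) (normalClosure_smul X Y e he)

variable (he : ∀ j (a : Q j) x, e j (ψ j a • x) = φ j a • e j x)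

lemma ofRight_smul_glue (g : P') (x : X.carrier) :
    (ofRight ψ φ g • (show (glue X Y e he).carrier from x) : (glue X Y e he).carrier) =
      (e 0).symm (g • e 0 x) := rfl

lemma ofPath_smul_glue (i j : Fin s) (x : X.carrier) :
    (ofPath ψ φ (PathGroup.u i j) • (show (glue X Y e he).carrier from x) :
      (glue X Y e he).carrier) = (e i).symm (e j x) :=
  PathGroup.permHom_u e i j x

/-- A pair of equivariant maps that is compatible with the bijections is equivariant on the
glued set. -/
lemma map_smul_of_glue (S : GSet.{w} (VKGroup.{w} ψ φ)) (f : X.carrier → S.carrier)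
    (f' : Y.carrier → S.carrier) (hf : ∀ g x, f (g • x) = ofLeft ψ φ g • f x)
    (hf' : ∀ g y, f' (g • y) = ofRight ψ φ g • f' y)
    (hff' : ∀ j x, f' (e j x) = ofPath ψ φ (PathGroup.v j) • f x)
    (σ : VKGroup.{w} ψ φ) (x : (glue X Y e he).carrier) : f (σ • x) = σ • f x := by
  refine map_smul ψ φ (X := glue X Y e he) (Y := S) f hf (fun g x => ?_) (fun i j x => ?_) σ x
  · have h0 : ∀ x, f' (e 0 x) = f x := fun x => by
      rw [hff', PathGroup.v, PathGroup.u_self, map_one, one_smul]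
    have key : ∀ x, f ((e 0).symm (g • e 0 x)) = ofRight ψ φ g • f x := fun x => by
      rw [← h0, Equiv.apply_symm_apply, hf', h0]
    exact (congrArg f (ofRight_smul_glue X Y e he g x)).trans (key x)
  · have key : ∀ x, f ((e i).symm (e j x)) = ofPath ψ φ (PathGroup.u i j) • f x := fun x => by
      rw [← PathGroup.inv_v_mul_v, map_mul, map_inv, mul_smul, eq_inv_smul_iff, ← hff', ← hff',
        Equiv.apply_symm_apply]
    exact (congrArg f (ofPath_smul_glue X Y e he i j x)).trans (key x)

end VKGroup

end Glue

/-! ### The 2-fibre product as a category of `VKGroup`-sets -/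

section FibreProductGlue

variable {C : Type u₁} [Category.{v₁} C] {F : C ⥤ Type w}
  {D : Type u₂} [Category.{v₂} D] {G : D ⥤ Type w}
  {s : ℕ} {E : Fin s → Type u} [∀ j, Category.{v} (E j)]
  {H : ∀ j, E j ⥤ Type w} {t : ∀ j, C ⥤ E j} {t' : ∀ j, D ⥤ E j}
  (α : ∀ j, t j ⋙ H j ≅ F) (β : ∀ j, t' j ⋙ H j ≅ G)

/-- The components of the isomorphism that is part of an object of the 2-fibre product. -/
def componentIso (X : FibreProduct t t') (j : Fin s) : (t j).obj X.fst ≅ (t' j).obj X.snd :=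
  Pi.isoApp X.iso j

lemma map_comp_componentIso {X Y : FibreProduct t t'} (f : X ⟶ Y) (j : Fin s) :
    (t j).map f.fst ≫ (componentIso Y j).hom = (componentIso X j).hom ≫ (t' j).map f.snd :=
  congrFun f.w j

/-- The bijections between the fibres given by an object of the 2-fibre product. -/
def fibreEquiv (X : FibreProduct t t') (j : Fin s) : F.obj X.fst ≃ G.obj X.snd :=
  ((α j).symm.app X.fst ≪≫ (H j).mapIso (componentIso X j) ≪≫ (β j).app X.snd).toEquiv

lemma fibreEquiv_apply (X : FibreProduct t t') (j : Fin s) (x : F.obj X.fst) :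
    fibreEquiv α β X j x =
      (β j).hom.app X.snd ((H j).map (componentIso X j).hom ((α j).inv.app X.fst x)) := rfl

lemma hom_inv_app (j : Fin s) (X : C) (x : (H j).obj ((t j).obj X)) :
    (α j).inv.app X ((α j).hom.app X x) = x :=
  Iso.hom_inv_id_app_apply (α j) X x

lemma inv_hom_app (j : Fin s) (X : C) (x : F.obj X) :
    (α j).hom.app X ((α j).inv.app X x) = x :=
  Iso.inv_hom_id_app_apply (α j) X x

lemma hom_app_map (j : Fin s) {X Y : C} (f : X ⟶ Y) (x : (H j).obj ((t j).obj X)) :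
    (α j).hom.app Y ((H j).map ((t j).map f) x) = F.map f ((α j).hom.app X x) :=
  ConcreteCategory.congr_hom ((α j).hom.naturality f) x

lemma inv_app_map (j : Fin s) {X Y : C} (f : X ⟶ Y) (x : F.obj X) :
    (α j).inv.app Y (F.map f x) = (H j).map ((t j).map f) ((α j).inv.app X x) :=
  ConcreteCategory.congr_hom ((α j).inv.naturality f) x

lemma hom_app_autAction (j : Fin s) (X : C) (σ : Aut (H j)) (z : (H j).obj ((t j).obj X)) :
    (α j).hom.app X (autAction (H j) σ _ z) =
      autAction F (pi1Map (t j) (α j) σ) X ((α j).hom.app X z) := by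
  rw [autAction_pi1Map, hom_inv_app]

/-- Naturality of `σ` along the component isomorphism in `E j`. This is the condition that glueing
needs. -/
lemma fibreEquiv_autAction (X : FibreProduct t t') (j : Fin s) (σ : Aut (H j))
    (x : F.obj X.fst) :
    fibreEquiv α β X j (autAction F (pi1Map (t j) (α j) σ) X.fst x) =
      autAction G (pi1Map (t' j) (β j) σ) X.snd (fibreEquiv α β X j x) := by
  rw [autAction_pi1Map, autAction_pi1Map, fibreEquiv_apply, fibreEquiv_apply, hom_inv_app,
    hom_inv_app, autAction_map]

lemma fibreEquiv_map {X Y : FibreProduct t t'} (f : X ⟶ Y) (j : Fin s) (x : F.obj X.fst) :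
    fibreEquiv α β Y j (F.map f.fst x) = G.map f.snd (fibreEquiv α β X j x) := by
  rw [fibreEquiv_apply, fibreEquiv_apply, inv_app_map, ← hom_app_map, ← (H j).map_comp_apply,
    ← (H j).map_comp_apply, map_comp_componentIso]

variable [NeZero s]

/-- The quotient group whose Noohi completion is the fundamental group of the 2-fibre product. -/
abbrev FibreVKGroup : Type (max (max u₁ w) (max u₂ w) (w + 1)) :=
  VKGroup.{w} (fun j => pi1Map (t j) (α j)) (fun j => pi1Map (t' j) (β j))

/-- The map from the fundamental group of the first category. -/
def piLeft : Aut F →ₜ* FibreVKGroup α β :=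
  VKGroup.ofLeft (fun j => pi1Map (t j) (α j)) (fun j => pi1Map (t' j) (β j))

/-- The map from the fundamental group of the second category. -/
def piRight : Aut G →ₜ* FibreVKGroup α β :=
  VKGroup.ofRight (fun j => pi1Map (t j) (α j)) (fun j => pi1Map (t' j) (β j))

/-- The map from the group of paths. -/
def piPath : PathGroup s →ₜ* FibreVKGroup α β :=
  VKGroup.ofPath (fun j => pi1Map (t j) (α j)) (fun j => pi1Map (t' j) (β j))

lemma piPath_mul_piLeft (j : Fin s) (σ : Aut (H j)) :
    piPath α β (PathGroup.v j) * piLeft α β (pi1Map (t j) (α j) σ) =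
      piRight α β (pi1Map (t' j) (β j) σ) * piPath α β (PathGroup.v j) :=
  VKGroup.ofPath_mul_ofLeft (fun j => pi1Map (t j) (α j)) (fun j => pi1Map (t' j) (β j)) j σ

/-- The set with an action of `FibreVKGroup` given by an object of the 2-fibre product. -/
def glueObj (X : FibreProduct t t') : GSet.{w} (FibreVKGroup α β) :=
  VKGroup.glue ((fibreGSet F).obj X.fst) ((fibreGSet G).obj X.snd) (fibreEquiv α β X)
    fun j σ x => fibreEquiv_autAction α β X j σ x

/-- The identification of the underlying set of `glueObj`. -/
def glueObjEquiv (X : FibreProduct t t') : F.obj X.fst ≃ (glueObj α β X).carrier := Equiv.refl _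

lemma piLeft_smul (X : FibreProduct t t') (σ : Aut F) (x : F.obj X.fst) :
    piLeft α β σ • glueObjEquiv α β X x = glueObjEquiv α β X (autAction F σ X.fst x) := rfl

lemma piRight_smul (X : FibreProduct t t') (σ : Aut G) (x : F.obj X.fst) :
    piRight α β σ • glueObjEquiv α β X x = glueObjEquiv α β X
      ((fibreEquiv α β X 0).symm (autAction G σ X.snd (fibreEquiv α β X 0 x))) := rfl

lemma piPath_smul (X : FibreProduct t t') (i j : Fin s) (x : F.obj X.fst) :
    piPath α β (PathGroup.u i j) • glueObjEquiv α β X x = glueObjEquiv α β X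
      ((fibreEquiv α β X i).symm (fibreEquiv α β X j x)) :=
  VKGroup.ofPath_smul_glue ((fibreGSet F).obj X.fst) ((fibreGSet G).obj X.snd) (fibreEquiv α β X)
    (fun j σ x => fibreEquiv_autAction α β X j σ x) i j x

/-- The morphism from `glueObj` given by a compatible pair of equivariant maps. -/
def glueObjHom (X : FibreProduct t t') (S : GSet.{w} (FibreVKGroup α β))
    (f : F.obj X.fst → S.carrier) (f' : G.obj X.snd → S.carrier)
    (hf : ∀ σ x, f (autAction F σ X.fst x) = piLeft α β σ • f x)
    (hf' : ∀ σ y, f' (autAction G σ X.snd y) = piRight α β σ • f' y)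
    (hff' : ∀ j x, f' (fibreEquiv α β X j x) = piPath α β (PathGroup.v j) • f x) :
    glueObj α β X ⟶ S :=
  GSet.homMk (fun x => f ((glueObjEquiv α β X).symm x))
    (VKGroup.map_smul_of_glue ((fibreGSet F).obj X.fst) ((fibreGSet G).obj X.snd)
      (fibreEquiv α β X) (fun j σ x => fibreEquiv_autAction α β X j σ x) S f f' hf hf' hff')

/-- The functor from the 2-fibre product to the category of `FibreVKGroup`-sets. -/
def glueFunctor : FibreProduct t t' ⥤ GSet.{w} (FibreVKGroup α β) where
  obj := glueObj α β
  map {X Y} f := glueObjHom α β X (glueObj α β Y) (fun x => glueObjEquiv α β Y (F.map f.fst x))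
    -- The glued set is the fibre of the first component, so the second component is read through
    -- the bijection of index `0`.
    (fun y => glueObjEquiv α β Y ((fibreEquiv α β Y 0).symm (G.map f.snd y)))
    (fun σ x => by rw [piLeft_smul, autAction_map])
    (fun σ y => by rw [piRight_smul, Equiv.apply_symm_apply, autAction_map])
    (fun j x => by rw [PathGroup.v, piPath_smul, fibreEquiv_map])
  map_id X := GSet.hom_ext fun x => F.map_id_apply X.fst x
  map_comp f g := GSet.hom_ext fun x => F.map_comp_apply f.fst g.fst x

/-- The functor to `VKGroup`-sets is compatible with the functors to sets. -/
def glueFunctorCompForget : glueFunctor α β ⋙ GSet.forget _ ≅ fibreProductFunctor t t' F :=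
  NatIso.ofComponents (fun _ => Iso.refl _) fun _ => by ext; rfl

lemma glueFunctor_faithful (hF : F.Faithful) (hG : G.Faithful) :
    (glueFunctor α β).Faithful where
  map_injective {X Y f g} h := by
    have h₁ : ∀ x, F.map f.fst x = F.map g.fst x := fun x =>
      congrArg (fun k => k.1 (glueObjEquiv α β X x)) h
    have h₂ : ∀ y, G.map f.snd y = G.map g.snd y := fun y => by
      obtain ⟨x, rfl⟩ := (fibreEquiv α β X 0).surjective y
      rw [← fibreEquiv_map, h₁, fibreEquiv_map]
    exact CategoricalPullback.hom_ext (F.map_injective (by ext x; exact h₁ x))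
      (G.map_injective (by ext y; exact h₂ y))

/-- An equivariant map gives a morphism in `C` directly and one in `D` after transport along the
bijections of index `0`. Equivariance under paths makes the pair compatible with all the other
bijections. -/
lemma glueFunctor_full (hF : IsTameInfiniteGalois F) (hG : IsTameInfiniteGalois G)
    (hH : ∀ j, (H j).Faithful) : (glueFunctor α β).Full where
  map_surjective {X Y} f := by
    have := hF.full
    have := hG.full
    let f₀ : F.obj X.fst → F.obj Y.fst := fun x =>
      (glueObjEquiv α β Y).symm (f.1 (glueObjEquiv α β X x))
    have hf : ∀ (σ : FibreVKGroup α β) (x : (glueObj α β X).carrier), f.1 (σ • x) = σ • f.1 x :=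
      f.2
    have hf' : ∀ x, f.1 (glueObjEquiv α β X x) = glueObjEquiv α β Y (f₀ x) := fun x => rfl
    have hl : ∀ σ x, f₀ (autAction F σ X.fst x) = autAction F σ Y.fst (f₀ x) := fun σ x => by
      apply (glueObjEquiv α β Y).injective
      rw [← hf', ← piLeft_smul, ← piLeft_smul, ← hf']
      exact hf _ _
    have hr : ∀ σ x, f₀ ((fibreEquiv α β X 0).symm (autAction G σ _ (fibreEquiv α β X 0 x))) =
        (fibreEquiv α β Y 0).symm (autAction G σ _ (fibreEquiv α β Y 0 (f₀ x))) := fun σ x => by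
      apply (glueObjEquiv α β Y).injective
      rw [← hf', ← piRight_smul, ← piRight_smul, ← hf']
      exact hf _ _
    have hp : ∀ (i j : Fin s) (x : F.obj X.fst),
        f₀ ((fibreEquiv α β X i).symm (fibreEquiv α β X j x)) =
          (fibreEquiv α β Y i).symm (fibreEquiv α β Y j (f₀ x)) := fun i j x => by
      apply (glueObjEquiv α β Y).injective
      rw [← hf', ← piPath_smul, ← piPath_smul, ← hf']
      exact hf _ _
    obtain ⟨a, ha⟩ := (fibreGSet F).map_surjective
      (GSet.homMk (X := (fibreGSet F).obj X.fst) (Y := (fibreGSet F).obj Y.fst) f₀ hl)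
    obtain ⟨b, hb⟩ := (fibreGSet G).map_surjective
      (GSet.homMk (X := (fibreGSet G).obj X.snd) (Y := (fibreGSet G).obj Y.snd)
        (fun y => fibreEquiv α β Y 0 (f₀ ((fibreEquiv α β X 0).symm y))) fun σ y => by
          obtain ⟨x, rfl⟩ := (fibreEquiv α β X 0).surjective y
          rw [Equiv.symm_apply_apply]
          exact (congrArg (fibreEquiv α β Y 0) (hr σ x)).trans (Equiv.apply_symm_apply _ _))
    have ha' : ∀ x, F.map a x = f₀ x := fun x => congrArg (fun k => k.1 x) ha
    have hb' : ∀ y, G.map b y = fibreEquiv α β Y 0 (f₀ ((fibreEquiv α β X 0).symm y)) :=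
      fun y => congrArg (fun k => k.1 y) hb
    -- Since `H j` is faithful and `α j`, `β j` are bijective on fibres, the square is checked on
    -- `F`-fibres, where it is `hp` with first index `0`.
    have hw : ∀ j, (t j).map a ≫ (componentIso Y j).hom =
        (componentIso X j).hom ≫ (t' j).map b := fun j => by
      refine (H j).map_injective ?_
      ext z
      change (H j).map ((t j).map a ≫ (componentIso Y j).hom) z =
        (H j).map ((componentIso X j).hom ≫ (t' j).map b) z
      apply ((isIso_iff_bijective ((β j).hom.app Y.snd)).1 inferInstance).1
      obtain ⟨x, rfl⟩ := ((isIso_iff_bijective ((α j).inv.app X.fst)).1 inferInstance).2 z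
      rw [(H j).map_comp_apply, (H j).map_comp_apply, ← inv_app_map, hom_app_map,
        ← fibreEquiv_apply, ← fibreEquiv_apply, ha', hb', hp, Equiv.apply_symm_apply]
    exact ⟨⟨a, b, funext hw⟩, GSet.hom_ext ha'⟩

lemma glueFunctor_essSurj (hF : IsTameInfiniteGalois F) (hG : IsTameInfiniteGalois G)
    (hH : ∀ j, IsTameInfiniteGalois (H j)) : (glueFunctor α β).EssSurj where
  mem_essImage S := by
    have := hF.essSurj
    have := hG.essSurj
    have := fun j => (hH j).isEquivalence_fibreGSet
    let a := (fibreGSet F).objObjPreimageIso (S.restrict (piLeft α β))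
    let b := (fibreGSet G).objObjPreimageIso (S.restrict (piRight α β))
    let X := (fibreGSet F).objPreimage (S.restrict (piLeft α β))
    let Y := (fibreGSet G).objPreimage (S.restrict (piRight α β))
    let p : F.obj X ≃ S.carrier := ((GSet.forget _).mapIso a).toEquiv
    let q : G.obj Y ≃ S.carrier := ((GSet.forget _).mapIso b).toEquiv
    have hp : ∀ σ x, p (autAction F σ X x) = piLeft α β σ • p x := fun σ x => a.hom.2 σ x
    have hq : ∀ σ y, q (autAction G σ Y y) = piRight α β σ • q y := fun σ y => b.hom.2 σ y
    -- The action of the path `v j` on `S`, read in the fibres of `H j`; this is the bijection that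
    -- glueing must produce.
    let m : ∀ j, (H j).obj ((t j).obj X) ≃ (H j).obj ((t' j).obj Y) := fun j =>
      ((α j).app X).toEquiv.trans (p.trans ((MulAction.toPerm
        (piPath α β (PathGroup.v j))).trans (q.symm.trans ((β j).app Y).symm.toEquiv)))
    have hm : ∀ j z, q ((β j).hom.app Y (m j z)) =
        piPath α β (PathGroup.v j) • p ((α j).hom.app X z) := fun j z => by
      change q ((β j).hom.app Y ((β j).inv.app Y (q.symm _))) = _
      rw [inv_hom_app, Equiv.apply_symm_apply]
      rfl
    have hmσ : ∀ j (σ : Aut (H j)) z, m j (autAction (H j) σ _ z) =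
        autAction (H j) σ _ (m j z) := fun j σ z => by
      apply ((isIso_iff_bijective ((β j).hom.app Y)).1 inferInstance).1
      apply q.injective
      -- The relations of `VKGroup` enter here: they make `m j` equivariant for `Aut (H j)`, so that
      -- it lifts to `E j`.
      rw [hm, hom_app_autAction, hom_app_autAction, hp, hq, hm, ← mul_smul, ← mul_smul,
        piPath_mul_piLeft]
    let n : ∀ j, (fibreGSet (H j)).obj ((t j).obj X) ⟶ (fibreGSet (H j)).obj ((t' j).obj Y) :=
      fun j => GSet.homMk (m j) (hmσ j)
    have hn : ∀ j, IsIso (n j) := fun j => GSet.isIso_of_bijective (n j) (m j).bijective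
    let l : ∀ j, (t j).obj X ≅ (t' j).obj Y := fun j => (fibreGSet (H j)).preimageIso (asIso (n j))
    have hl : ∀ j z, (H j).map (l j).hom z = m j z := fun j z =>
      congrArg (fun k => k.1 z) ((fibreGSet (H j)).map_preimage (n j))
    let Z : FibreProduct t t' := ⟨X, Y, Pi.isoMk l⟩
    have hZ : ∀ j (x : F.obj X), q (fibreEquiv α β Z j x) =
        piPath α β (PathGroup.v j) • p x := fun j x => by
      change q ((β j).hom.app Y ((H j).map (l j).hom ((α j).inv.app X x))) = _
      rw [hl, hm, inv_hom_app]
    let f : (glueFunctor α β).obj Z ⟶ S := glueObjHom α β Z S p q hp hq hZ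
    have : IsIso f := GSet.isIso_of_bijective f p.bijective
    exact ⟨Z, ⟨asIso f⟩⟩

theorem isEquivalence_glueFunctor (hF : IsTameInfiniteGalois F) (hG : IsTameInfiniteGalois G)
    (hH : ∀ j, IsTameInfiniteGalois (H j)) : (glueFunctor α β).IsEquivalence where
  faithful := glueFunctor_faithful α β hF.faithful hG.faithful
  full := glueFunctor_full α β hF hG fun j => (hH j).faithful
  essSurj := glueFunctor_essSurj α β hF hG hH

end FibreProductGlue

end VanKampen

end
open VanKampen in
theorem proposition1p10
    {C : Type u₁} [Category.{v₁} C] (F : C ⥤ Type w) (hF : IsTameInfiniteGalois F)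
    {D : Type u₂} [Category.{v₂} D] (G : D ⥤ Type w) (hG : IsTameInfiniteGalois G)
    (s : ℕ) [NeZero s] {E : Fin s → Type u} [∀ j, Category.{v} (E j)]
    (H : ∀ j, E j ⥤ Type w) (hH : ∀ j, IsTameInfiniteGalois (H j))
    (t : ∀ j, C ⥤ E j) (t' : ∀ j, D ⥤ E j)
    (α : ∀ j, t j ⋙ H j ≅ F) (β : ∀ j, t' j ⋙ H j ≅ G) :
    IsTameInfiniteGalois (fibreProductFunctor t t' F) ∧
    Nonempty (Aut (fibreProductFunctor t t' F) ≃ₜ*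
      VK.{w} (fun j => pi1Map (t j) (α j)) (fun j => pi1Map (t' j) (β j))) := by
  have := isEquivalence_glueFunctor α β hF hG hH
  have := hF.small_aut
  have := hG.small_aut
  exact ⟨isTameInfiniteGalois_of_isEquivalence _ _ (glueFunctorCompForget α β),
    ⟨autContinuousMulEquiv _ (glueFunctorCompForget α β)⟩⟩
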